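/- Let $n_1,n_2\ge 1$, $0<\delta<1$, $\mu>0$, $c,\bar c>0$, $a_p,\bar a_q>0$ and $d_{qps},\bar d_{pqr},I_p,J_q\in\mathbb R$, where $p,r$ range over $1,\dots,n_1$ and $q,s$ over $1,\dots,n_2$. Consider the system, for $t>0$, $$D_C^\delta[x_p(t)-c\,x_p(t-\mu)]=-a_px_p(t)+\sum_{q,s}d_{qps}\int_0^\infty k_{qps}(w)g_q(y_q(t-w))\,dw\int_0^\infty h_{qps}(w)g_s(y_s(t-w))\,dw+I_p,$$ $$D_C^\delta[y_q(t)-\bar c\,y_q(t-\mu)]=-\bar a_qy_q(t)+\sum_{p,r}\bar d_{pqr}\int_0^\infty\bar k_{pqr}(w)\bar g_p(x_p(t-w))\,dw\int_0^\infty\bar h_{pqr}(w)\bar g_r(x_r(t-w))\,dw+J_q,$$ with histories $x_p=\phi_p$, $y_q=\varphi_q$ on $(-\infty,0]$, where $D_C^\delta f(t)=\frac1{\Gamma(1-\delta)}\int_0^t(t-w)^{-\delta}f'(w)\,dw$ is the Caputo derivative. A solution consists of continuous functions $x_p,y_q$ on $\mathbb R$ with the given histories such that the integrals over $(0,\infty)$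 converge absolutely, $x_p-c\,x_p(\cdot-\mu)$ and $y_q-\bar c\,y_q(\cdot-\mu)$ are absolutely continuous on every $[0,T]$, and the equations hold for almost every $t>0$. Write $\hat k=\int_0^\infty k(s)\,ds$ for a kernel $k$, and $E_{\delta,\rho}(z)=\sum_{k\ge0}z^k/\Gamma(\delta k+\rho)$, $E_\delta=E_{\delta,1}$. Expressions $E_\delta(-\xi\lambda^\delta)$ with $\lambda<0$ are understood as $E_\delta(0)=1$. Assume: (A1) all kernels $k_{qps},h_{qps},\bar k_{pqr},\bar h_{pqr}$ are piecewise continuous, nonnegative and of finite integral on $[0,\infty)$; (A3) $|g_q(x)-g_q(y)|\le L_q|x-y|$ and $|\bar g_p(x)-\bar g_p(y)|\le M_p|x-y|$ for all real $x,y$ (the functions $g_q,\bar g_p$ may be unbounded). Let $(x_p^*,y_q^*)$ be an equilibrium, i.e. $0=-a_px_p^*+\sum_{q,s}d_{qps}\hat k_{qps}g_q(y_q^*)\hat h_{qps}g_s(y_s^*)+I_p$ and $0=-\bar a_qy_q^*+\sum_{p,r}\bar d_{pqr}\hat{\bar k}_{pqr}\bar g_p(x_p^*)\hat{\bar h}_{pqr}\bar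 g_r(x_r^*)+J_q$. Put $a=\min_pa_p$, $\bar a=\min_q\bar a_q$, $\xi=\min\{a,\bar a\}$, $c^*=\max\{c,\bar c\}$, $A=\max\{\sum_pa_p,\sum_q\bar a_q\}$, $U=A\,\Gamma(1+\delta)\Gamma(1-\delta)/\xi$, $B=1+\xi\Gamma(1-\delta)(2\mu)^\delta$, $F=\frac1{\xi\mu^\delta}+2^\delta\Gamma(1-\delta)$, $B^*=\max\{B,F\}$, $$\theta=\sum_{p,q,s}|d_{qps}|\big(L_q\hat h_{qps}|g_s(y_s^*)|+L_s\hat k_{qps}|g_q(y_q^*)|\big),\qquad\bar\theta=\sum_{p,r,q}|\bar d_{pqr}|\big(M_p\hat{\bar h}_{pqr}|\bar g_r(x_r^*)|+M_r\hat{\bar k}_{pqr}|\bar g_p(x_p^*)|\big),$$ $\pi=\max\{\theta,\bar\theta\}$ (a constant, not the number $3.14\ldots$), and let $K^*(t)$ be the maximum of all the kernels $k_{qps},h_{qps},\bar k_{pqr},\bar h_{pqr}$ at $t$. Assume further: (A5) there is $\Omega>0$ with $\Omega\pi<\frac14$, $c^*<\min\{1,\frac1{2B^*(1+U)}\}$ and,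 for all $t>0$, $$\int_0^t(t-w)^{\delta-1}E_{\delta,\delta}(-\xi(t-w)^\delta)\Big(\int_{-\infty}^wE_\delta(-\xi\lambda^\delta)K^*(w-\lambda)\,d\lambda\Big)dw\le\Omega\,E_\delta(-\xi t^\delta).$$ Then the solutions are locally $\delta$-Mittag-Leffler stable: $\xi>0$, and there are constants $C,\varepsilon>0$ such that, whenever $(x,y)$ is a solution with histories $(\phi,\varphi)$ and $u_0,v_0>0$ satisfy $$\sum_p|\phi_p(w)-x_p^*|\le u_0E_\delta(-a(w+\mu)^\delta),\qquad\sum_q|\varphi_q(w)-y_q^*|\le v_0E_\delta(-\bar a(w+\mu)^\delta)\qquad(w\le0)$$ and $V_0:=\max\{u_0,v_0\}<\varepsilon$, then for all $t>0$ $$u(t):=\sum_p|x_p(t)-x_p^*|\le C\,V_0\,E_\delta(-\xi t^\delta),\qquad v(t):=\sum_q|y_q(t)-y_q^*|\le C\,V_0\,E_\delta(-\xi t^\delta).$$ -/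

import Mathlib

open MeasureTheory Set Filter Topology

noncomputable section

/-- The two-parametric Mittag-Leffler function `E_{δ,ρ}(z) = ∑ z ^ k / Γ(δ k + ρ)` on the real
line. -/
def mittagLeffler₂ (δ ρ z : ℝ) : ℝ :=
  ∑' k : ℕ, z ^ k / Real.Gamma (δ * k + ρ)

/-- The one-parametric Mittag-Leffler function `E_δ = E_{δ,1}`. -/
def mittagLeffler (δ z : ℝ) : ℝ :=
  mittagLeffler₂ δ 1 z

/-- The function `t ↦ E_δ(-ξ t ^ δ)`, continued to `t < 0` by its value `1` at `t = 0`. -/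
def mlDecay (δ ξ t : ℝ) : ℝ :=
  mittagLeffler δ (-ξ * (max t 0) ^ δ)

/-- The Caputo fractional derivative of order `δ ∈ (0, 1)` with base point `0`. -/
def caputoDeriv (δ : ℝ) (f : ℝ → ℝ) (t : ℝ) : ℝ :=
  1 / Real.Gamma (1 - δ) * ∫ w in (0 : ℝ)..t, (t - w) ^ (-δ) * deriv f w

/-- Piecewise continuity on `[0, ∞)`: one-sided limits exist everywhere, and on each bounded
interval there are only finitely many discontinuities. -/
structure PiecewiseContinuous (f : ℝ → ℝ) : Prop where
  finite_disc : ∀ T : ℝ, {t ∈ Icc 0 T | ¬ ContinuousWithinAt f (Ici 0) t}.Finite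
  right_lim : ∀ t : ℝ, 0 ≤ t → ∃ l : ℝ, Tendsto f (𝓝[>] t) (𝓝 l)
  left_lim : ∀ t : ℝ, 0 < t → ∃ l : ℝ, Tendsto f (𝓝[<] t) (𝓝 l)

/-- A delay kernel: piecewise continuous, nonnegative and of finite integral on `[0, ∞)`. -/
structure IsDelayKernel (k : ℝ → ℝ) : Prop where
  piecewiseContinuous : PiecewiseContinuous k
  nonneg : ∀ s : ℝ, 0 ≤ s → 0 ≤ k s
  integrableOn : IntegrableOn k (Ioi 0)

/-- The integral `∫_0^∞ k(s) ds`. -/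
def kernelMass (k : ℝ → ℝ) : ℝ :=
  ∫ s in Ioi (0 : ℝ), k s

/-- The data of a high-order fractional BAM neural network with `n₁ + n₂` neurons, distributed
delays and neutral delay `μ`. The indices of `d`, `k`, `h` are in the order `q p s`, those of
`dbar`, `kbar`, `hbar` in the order `p q r`. -/
structure BAMNetwork (n₁ n₂ : ℕ) where
  /-- order of the fractional derivative -/
  δ : ℝ
  /-- neutral delay -/
  μ : ℝ
  /-- neutral coefficients -/
  c : ℝ
  cbar : ℝ
  /-- dissipation coefficients -/
  a : Fin n₁ → ℝ
  abar : Fin n₂ → ℝ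
  /-- second order parameters -/
  d : Fin n₂ → Fin n₁ → Fin n₂ → ℝ
  dbar : Fin n₁ → Fin n₂ → Fin n₁ → ℝ
  /-- delay kernels -/
  k : Fin n₂ → Fin n₁ → Fin n₂ → ℝ → ℝ
  h : Fin n₂ → Fin n₁ → Fin n₂ → ℝ → ℝ
  kbar : Fin n₁ → Fin n₂ → Fin n₁ → ℝ → ℝ
  hbar : Fin n₁ → Fin n₂ → Fin n₁ → ℝ → ℝ
  /-- activation functions -/
  g : Fin n₂ → ℝ → ℝ
  gbar : Fin n₁ → ℝ → ℝ
  /-- external inputs -/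
  I : Fin n₁ → ℝ
  J : Fin n₂ → ℝ
  δ_pos : 0 < δ
  δ_lt_one : δ < 1
  μ_pos : 0 < μ
  c_pos : 0 < c
  cbar_pos : 0 < cbar
  a_pos : ∀ p, 0 < a p
  abar_pos : ∀ q, 0 < abar q

namespace BAMNetwork

variable {n₁ n₂ : ℕ} (N : BAMNetwork n₁ n₂)

/-- Right-hand side of the equation for `x_p`. -/
def rhsX (x : Fin n₁ → ℝ → ℝ) (y : Fin n₂ → ℝ → ℝ) (p : Fin n₁) (t : ℝ) : ℝ :=
  -N.a p * x p t
    + ∑ q, ∑ s, N.d q p s * (∫ w in Ioi (0 : ℝ), N.k q p s w * N.g q (y q (t - w)))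
        * (∫ w in Ioi (0 : ℝ), N.h q p s w * N.g s (y s (t - w)))
    + N.I p

/-- Right-hand side of the equation for `y_q`. -/
def rhsY (x : Fin n₁ → ℝ → ℝ) (y : Fin n₂ → ℝ → ℝ) (q : Fin n₂) (t : ℝ) : ℝ :=
  -N.abar q * y q t
    + ∑ p, ∑ r, N.dbar p q r * (∫ w in Ioi (0 : ℝ), N.kbar p q r w * N.gbar p (x p (t - w)))
        * (∫ w in Ioi (0 : ℝ), N.hbar p q r w * N.gbar r (x r (t - w)))
    + N.J q

/-- `(x, y)` is a solution of the network with history functions `(φ, ψ)`: the components are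
continuous, the distributed delay integrals exist, the neutral combinations are absolutely
continuous on bounded intervals `[0, T]`, and the Caputo equations hold for almost every
`t > 0`. -/
structure IsSolution (φ : Fin n₁ → ℝ → ℝ) (ψ : Fin n₂ → ℝ → ℝ)
    (x : Fin n₁ → ℝ → ℝ) (y : Fin n₂ → ℝ → ℝ) : Prop where
  continuous_x : ∀ p, Continuous (x p)
  continuous_y : ∀ q, Continuous (y q)
  history_x : ∀ p, ∀ t ≤ 0, x p t = φ p t
  history_y : ∀ q, ∀ t ≤ 0, y q t = ψ q t
  integrable_k : ∀ q p s, ∀ t > 0,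
    IntegrableOn (fun w => N.k q p s w * N.g q (y q (t - w))) (Ioi 0)
  integrable_h : ∀ q p s, ∀ t > 0,
    IntegrableOn (fun w => N.h q p s w * N.g s (y s (t - w))) (Ioi 0)
  integrable_kbar : ∀ p q r, ∀ t > 0,
    IntegrableOn (fun w => N.kbar p q r w * N.gbar p (x p (t - w))) (Ioi 0)
  integrable_hbar : ∀ p q r, ∀ t > 0,
    IntegrableOn (fun w => N.hbar p q r w * N.gbar r (x r (t - w))) (Ioi 0)
  absCont_x : ∀ p, ∀ T > 0,
    AbsolutelyContinuousOnInterval (fun t => x p t - N.c * x p (t - N.μ)) 0 T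
  absCont_y : ∀ q, ∀ T > 0,
    AbsolutelyContinuousOnInterval (fun t => y q t - N.cbar * y q (t - N.μ)) 0 T
  eq_x : ∀ p, ∀ᵐ t : ℝ, 0 < t →
    caputoDeriv N.δ (fun t => x p t - N.c * x p (t - N.μ)) t = N.rhsX x y p t
  eq_y : ∀ q, ∀ᵐ t : ℝ, 0 < t →
    caputoDeriv N.δ (fun t => y q t - N.cbar * y q (t - N.μ)) t = N.rhsY x y q t

/-- `(xs, ys)` is an equilibrium of the network. -/
structure IsEquilibrium (xs : Fin n₁ → ℝ) (ys : Fin n₂ → ℝ) : Prop where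
  eq_x : ∀ p, 0 = -N.a p * xs p
    + ∑ q, ∑ s, N.d q p s * kernelMass (N.k q p s) * N.g q (ys q)
        * kernelMass (N.h q p s) * N.g s (ys s)
    + N.I p
  eq_y : ∀ q, 0 = -N.abar q * ys q
    + ∑ p, ∑ r, N.dbar p q r * kernelMass (N.kbar p q r) * N.gbar p (xs p)
        * kernelMass (N.hbar p q r) * N.gbar r (xs r)
    + N.J q

/-- Assumption on the delay kernels. -/
structure KernelAssumption : Prop where
  kernel_k : ∀ q p s, IsDelayKernel (N.k q p s)
  kernel_h : ∀ q p s, IsDelayKernel (N.h q p s)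
  kernel_kbar : ∀ p q r, IsDelayKernel (N.kbar p q r)
  kernel_hbar : ∀ p q r, IsDelayKernel (N.hbar p q r)

/-- Lipschitz continuity of the (possibly unbounded) activation functions. -/
structure LipschitzActivations (L : Fin n₂ → ℝ) (M : Fin n₁ → ℝ) : Prop where
  lip_g : ∀ q, ∀ x y : ℝ, |N.g q x - N.g q y| ≤ L q * |x - y|
  lip_gbar : ∀ p, ∀ x y : ℝ, |N.gbar p x - N.gbar p y| ≤ M p * |x - y|

/-- `min_p a_p`. -/
def aMin : ℝ := ⨅ p, N.a p

/-- `min_q abar_q`. -/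
def abarMin : ℝ := ⨅ q, N.abar q

/-- The decay parameter `ξ`. -/
def ξ : ℝ := min N.aMin N.abarMin

/-- `c* = max {c, cbar}`. -/
def cStar : ℝ := max N.c N.cbar

/-- `A = max {∑ a_p, ∑ abar_q}`. -/
def bigA : ℝ := max (∑ p, N.a p) (∑ q, N.abar q)

/-- `U = A Γ(1+δ) Γ(1-δ) / ξ`. -/
def bigU : ℝ := N.bigA * (Real.Gamma (1 + N.δ) * Real.Gamma (1 - N.δ) / N.ξ)

/-- `B = 1 + ξ Γ(1-δ) (2μ)^δ`. -/
def bigB : ℝ := 1 + N.ξ * Real.Gamma (1 - N.δ) * (2 * N.μ) ^ N.δ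

/-- `F = 1 / (ξ μ^δ) + 2^δ Γ(1-δ)`. -/
def bigF : ℝ := 1 / (N.ξ * N.μ ^ N.δ) + 2 ^ N.δ * Real.Gamma (1 - N.δ)

/-- `B* = max {B, F}`. -/
def bStar : ℝ := max N.bigB N.bigF

/-- The constant `θ`, with absolute values since `d` and `g(y*)` may have any sign. -/
def theta (L : Fin n₂ → ℝ) (ys : Fin n₂ → ℝ) : ℝ :=
  ∑ p, ∑ q, ∑ s, |N.d q p s| *
    (L q * kernelMass (N.h q p s) * |N.g s (ys s)|
      + L s * kernelMass (N.k q p s) * |N.g q (ys q)|)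

/-- The constant `θbar`. -/
def thetaBar (M : Fin n₁ → ℝ) (xs : Fin n₁ → ℝ) : ℝ :=
  ∑ p, ∑ r, ∑ q, |N.dbar p q r| *
    (M p * kernelMass (N.hbar p q r) * |N.gbar r (xs r)|
      + M r * kernelMass (N.kbar p q r) * |N.gbar p (xs p)|)

/-- The constant `π = max {θ, θbar}` (not the number). -/
def piConst (L : Fin n₂ → ℝ) (M : Fin n₁ → ℝ) (xs : Fin n₁ → ℝ) (ys : Fin n₂ → ℝ) : ℝ :=
  max (N.theta L ys) (N.thetaBar M xs)

/-- The maximum of all the kernels `k_{qps}` and `h_{qps}`. -/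
def kernelK (t : ℝ) : ℝ :=
  max (⨆ i : Fin n₂ × Fin n₁ × Fin n₂, N.k i.1 i.2.1 i.2.2 t)
    (⨆ i : Fin n₂ × Fin n₁ × Fin n₂, N.h i.1 i.2.1 i.2.2 t)

/-- The maximum of all the kernels `kbar_{pqr}` and `hbar_{pqr}`. -/
def kernelH (t : ℝ) : ℝ :=
  max (⨆ i : Fin n₁ × Fin n₂ × Fin n₁, N.kbar i.1 i.2.1 i.2.2 t)
    (⨆ i : Fin n₁ × Fin n₂ × Fin n₁, N.hbar i.1 i.2.1 i.2.2 t)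

/-- `K* = max {K, H}`. -/
def kStar (t : ℝ) : ℝ := max (N.kernelK t) (N.kernelH t)

/-- Smallness assumption, with constant `Ω`, for the equilibrium `(xs, ys)`. -/
structure SmallnessAssumption (L : Fin n₂ → ℝ) (M : Fin n₁ → ℝ) (xs : Fin n₁ → ℝ) (ys : Fin n₂ → ℝ)
    (Ω : ℝ) : Prop where
  Ω_pos : 0 < Ω
  Ω_small : Ω * N.piConst L M xs ys < 1 / 4
  c_small : N.cStar < min 1 (1 / (2 * N.bStar * (1 + N.bigU)))
  kernel_condition : ∀ t > 0,
    (∫ w in (0 : ℝ)..t, (t - w) ^ (N.δ - 1) *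
        mittagLeffler₂ N.δ N.δ (-N.ξ * (t - w) ^ N.δ) *
        ∫ l in Iic w, mlDecay N.δ N.ξ l * N.kStar (w - l))
      ≤ Ω * mittagLeffler N.δ (-N.ξ * t ^ N.δ)

end BAMNetwork

end

/-!
Measured from the equilibrium, the neutral combination `x_p(t) - c x_p(t - μ)` satisfies a linear
Caputo equation `D^δ z = -a_p z + f`, so variation of constants writes it as an initial term plus
the convolution of `f` with the kernel `t ^ (δ - 1) E_{δ,δ}(-a_p t ^ δ)`, which is positive and
bounded by the same kernel at the rate `ξ ≤ a_p`. The forcing `f` has a neutral part and an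
interaction part. Two-sided bounds for `E_δ(-ξ t ^ δ)` show that a shift by `μ` costs the factor
`B*` and that convolution with the kernel costs `Γ(1 + δ) Γ(1 - δ) / ξ`, which controls the neutral
part; (A5) controls the distributed delays of the interaction part. Expanding the products of
activations leaves a remainder quadratic in the deviation. Hence, for small data, a bound
`u, v ≤ R E_δ(-ξ t ^ δ)` valid before time `T` holds strictly at `T`, so by continuity it is never
lost.
-/

/-! ### The Mittag-Leffler series -/

theorem Gamma_div_Gamma_add_le {δ x : ℝ} (hδ : 0 < δ) (hδ1 : δ < 1) (hx : 0 < x) :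
    Real.Gamma x / Real.Gamma (x + δ) ≤ (x + δ) ^ (1 - δ) / x := by
  have hG := Real.Gamma_pos_of_pos (add_pos hx hδ)
  have logConvex := Real.Gamma_mul_add_mul_le_rpow_Gamma_mul_rpow_Gamma (add_pos hx hδ)
    (show 0 < x + δ + 1 by linarith) hδ (sub_pos.2 hδ1) (by ring)
  rw [show δ * (x + δ) + (1 - δ) * (x + δ + 1) = x + 1 by ring, Real.Gamma_add_one hx.ne',
    Real.Gamma_add_one (add_pos hx hδ).ne', Real.mul_rpow (by linarith) hG.le,
    mul_left_comm, ← Real.rpow_add hG, add_sub_cancel, Real.rpow_one] at logConvex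
  rw [div_le_div_iff₀ hG hx]
  linarith

theorem tendsto_Gamma_div_Gamma_add_of_lt_one {δ : ℝ} (hδ : 0 < δ) (hδ1 : δ < 1) :
    Tendsto (fun x : ℝ => Real.Gamma x / Real.Gamma (x + δ)) atTop (𝓝 0) := by
  have hlim : Tendsto (fun x : ℝ => (2 : ℝ) ^ (1 - δ) * x ^ (-δ)) atTop (𝓝 0) := by
    simpa using (tendsto_rpow_neg_atTop hδ).const_mul ((2 : ℝ) ^ (1 - δ))
  refine tendsto_of_tendsto_of_tendsto_of_le_of_le' tendsto_const_nhds hlim ?_ ?_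
  · filter_upwards [eventually_gt_atTop 0] with x hx
    exact div_nonneg (Real.Gamma_pos_of_pos hx).le (Real.Gamma_pos_of_pos (add_pos hx hδ)).le
  · filter_upwards [eventually_ge_atTop 1] with x hx
    have hx0 : 0 < x := by linarith
    refine (Gamma_div_Gamma_add_le hδ hδ1 hx0).trans ?_
    rw [div_le_iff₀ hx0, mul_assoc, ← Real.rpow_add_one hx0.ne', neg_add_eq_sub,
      ← Real.mul_rpow zero_le_two hx0.le]
    exact Real.rpow_le_rpow (by linarith) (by linarith) (by linarith)

theorem tendsto_Gamma_div_Gamma_add {δ : ℝ} (hδ : 0 < δ) :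
    Tendsto (fun x : ℝ => Real.Gamma x / Real.Gamma (x + δ)) atTop (𝓝 0) := by
  set η := min δ (1 / 2)
  have hη : 0 < η := lt_min hδ one_half_pos
  have hη1 : η < 1 := (min_le_right _ _).trans_lt one_half_lt_one
  refine tendsto_of_tendsto_of_tendsto_of_le_of_le' tendsto_const_nhds
    (tendsto_Gamma_div_Gamma_add_of_lt_one hη hη1) ?_ ?_ <;>
    filter_upwards [eventually_ge_atTop 2] with x hx
  · exact div_nonneg (Real.Gamma_pos_of_pos (by linarith)).le
      (Real.Gamma_pos_of_pos (by linarith)).le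
  · have hmono : Real.Gamma (x + η) ≤ Real.Gamma (x + δ) :=
      Real.Gamma_strictMonoOn_Ici.monotoneOn (mem_Ici.2 (by linarith)) (mem_Ici.2 (by linarith))
        (by gcongr; exact min_le_left _ _)
    exact div_le_div_of_nonneg_left (Real.Gamma_pos_of_pos (by linarith)).le
      (Real.Gamma_pos_of_pos (by linarith)) hmono

section Series

variable {δ ρ : ℝ}

theorem Gamma_mul_natCast_add_pos (hδ : 0 < δ) (hρ : 0 < ρ) (k : ℕ) :
    0 < Real.Gamma (δ * k + ρ) :=
  Real.Gamma_pos_of_pos (by positivity)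

/-- The Mittag-Leffler series as a formal power series. -/
noncomputable def mittagLefflerSeries (δ ρ : ℝ) : FormalMultilinearSeries ℝ ℝ ℝ :=
  FormalMultilinearSeries.ofScalars ℝ fun k : ℕ => (Real.Gamma (δ * k + ρ))⁻¹

theorem mittagLefflerSeries_radius (hδ : 0 < δ) (hρ : 0 < ρ) :
    (mittagLefflerSeries δ ρ).radius = ⊤ := by
  apply FormalMultilinearSeries.ofScalars_radius_eq_top_of_tendsto
  · exact Eventually.of_forall fun k => inv_ne_zero (Gamma_mul_natCast_add_pos hδ hρ k).ne'
  · have hlin : Tendsto (fun k : ℕ => δ * (k : ℝ) + ρ) atTop atTop :=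
      tendsto_atTop_add_const_right _ _ (tendsto_natCast_atTop_atTop.const_mul_atTop hδ)
    refine ((tendsto_Gamma_div_Gamma_add hδ).comp hlin).congr fun k => ?_
    have hsucc : δ * ((k.succ : ℕ) : ℝ) + ρ = δ * k + ρ + δ := by push_cast; ring
    have hk := Gamma_mul_natCast_add_pos hδ hρ k
    have hk' : 0 < Real.Gamma (δ * k + ρ + δ) := hsucc ▸ Gamma_mul_natCast_add_pos hδ hρ k.succ
    simp only [Function.comp, hsucc, norm_inv, Real.norm_eq_abs, abs_of_pos hk, abs_of_pos hk']
    field_simp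

theorem mittagLefflerSeries_apply (δ ρ z : ℝ) (k : ℕ) :
    (mittagLefflerSeries δ ρ k fun _ => z) = z ^ k / Real.Gamma (δ * k + ρ) := by
  rw [mittagLefflerSeries, FormalMultilinearSeries.ofScalars_apply_eq, smul_eq_mul,
    div_eq_inv_mul]

theorem summable_mittagLeffler₂ (hδ : 0 < δ) (hρ : 0 < ρ) (z : ℝ) :
    Summable fun k : ℕ => z ^ k / Real.Gamma (δ * k + ρ) := by
  simpa only [mittagLefflerSeries_apply] using (mittagLefflerSeries δ ρ).summable (x := z)
    (by simp [mittagLefflerSeries_radius hδ hρ])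

theorem continuous_mittagLeffler₂ (hδ : 0 < δ) (hρ : 0 < ρ) :
    Continuous (mittagLeffler₂ δ ρ) := by
  have hr := mittagLefflerSeries_radius hδ hρ
  have h := (mittagLefflerSeries δ ρ).continuousOn
  rw [hr, Metric.eball_top, continuousOn_univ] at h
  exact h.congr fun z => tsum_congr fun k => mittagLefflerSeries_apply δ ρ z k

theorem mittagLeffler₂_zero (δ ρ : ℝ) : mittagLeffler₂ δ ρ 0 = 1 / Real.Gamma ρ := by
  unfold mittagLeffler₂
  rw [tsum_eq_single 0 fun k hk => by simp [hk]]
  simp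

theorem mittagLeffler₂_eq_add (hδ : 0 < δ) (hρ : 0 < ρ) (z : ℝ) :
    mittagLeffler₂ δ ρ z = 1 / Real.Gamma ρ + z * mittagLeffler₂ δ (ρ + δ) z := by
  unfold mittagLeffler₂
  rw [(summable_mittagLeffler₂ hδ hρ z).tsum_eq_zero_add, ← tsum_mul_left]
  congr 1
  · simp
  · refine tsum_congr fun k => ?_
    rw [pow_succ, show δ * ((k + 1 : ℕ) : ℝ) + ρ = δ * k + (ρ + δ) by push_cast; ring]
    ring

end Series

/-! ### Fractional kernels -/

/-- The kernel `t ^ (α - 1) / Γ(α)` of the Riemann–Liouville integral of order `α`. -/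
noncomputable def fracKernel (α t : ℝ) : ℝ := t ^ (α - 1) / Real.Gamma α

/-- The kernel `t ^ (ρ - 1) E_{δ,ρ}(-ξ t ^ δ)`; for `ρ = δ` it is the fundamental
solution of the Caputo equation `D^δ z = -ξ z + f`, and for `ρ = 1` the relaxation function
`E_δ(-ξ t ^ δ)`. -/
noncomputable def mlKernel (δ ξ ρ t : ℝ) : ℝ := t ^ (ρ - 1) * mittagLeffler₂ δ ρ (-ξ * t ^ δ)

section FracKernel

variable {α β t : ℝ}

theorem fracKernel_nonneg (hα : 0 < α) (ht : 0 ≤ t) : 0 ≤ fracKernel α t :=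
  div_nonneg (Real.rpow_nonneg ht _) (Real.Gamma_pos_of_pos hα).le

theorem fracKernel_pos (hα : 0 < α) (ht : 0 < t) : 0 < fracKernel α t :=
  div_pos (Real.rpow_pos_of_pos ht _) (Real.Gamma_pos_of_pos hα)

theorem fracKernel_one (t : ℝ) : fracKernel 1 t = 1 := by simp [fracKernel]

theorem integral_rpow_mul_sub_rpow (hα : 0 < α) (hβ : 0 < β) (ht : 0 < t) :
    ∫ s in (0 : ℝ)..t, s ^ (α - 1) * (t - s) ^ (β - 1)
      = t ^ (α + β - 1) * ProbabilityTheory.beta α β := by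
  have hscaled := congrArg Complex.re (Complex.betaIntegral_scaled (α : ℂ) (β : ℂ) ht)
  have hcast : ∫ s in (0 : ℝ)..t, (s : ℂ) ^ ((α : ℂ) - 1) * ((t : ℂ) - s) ^ ((β : ℂ) - 1)
      = ((∫ s in (0 : ℝ)..t, s ^ (α - 1) * (t - s) ^ (β - 1) : ℝ) : ℂ) := by
    rw [← intervalIntegral.integral_ofReal]
    refine intervalIntegral.integral_congr fun s hs => ?_
    rw [uIcc_of_le ht.le] at hs
    push_cast [Complex.ofReal_cpow hs.1, Complex.ofReal_cpow (sub_nonneg.2 hs.2)]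
    rfl
  have hpow : (t : ℂ) ^ ((α : ℂ) + β - 1) = ((t ^ (α + β - 1) : ℝ) : ℂ) := by
    push_cast [Complex.ofReal_cpow ht.le]; rfl
  rwa [hcast, hpow, Complex.ofReal_re, Complex.re_ofReal_mul,
    ← ProbabilityTheory.beta_eq_betaIntegralReal α β hα hβ] at hscaled

theorem integral_fracKernel_mul_fracKernel (hα : 0 < α) (hβ : 0 < β) (ht : 0 < t) :
    ∫ s in (0 : ℝ)..t, fracKernel β (t - s) * fracKernel α s = fracKernel (α + β) t := by
  have hfactor : ∀ s : ℝ, fracKernel β (t - s) * fracKernel α s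
      = (Real.Gamma α * Real.Gamma β)⁻¹ * (s ^ (α - 1) * (t - s) ^ (β - 1)) := fun s => by
    unfold fracKernel; field_simp
  simp_rw [hfactor]
  rw [intervalIntegral.integral_const_mul, integral_rpow_mul_sub_rpow hα hβ ht, fracKernel,
    ProbabilityTheory.beta]
  field_simp [(Real.Gamma_pos_of_pos hα).ne', (Real.Gamma_pos_of_pos hβ).ne']

theorem intervalIntegrable_fracKernel (hα : 0 < α) (a b : ℝ) :
    IntervalIntegrable (fracKernel α) volume a b :=
  (intervalIntegral.intervalIntegrable_rpow' (by linarith)).div_const _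

theorem intervalIntegrable_fracKernel_mul (hα : 0 < α) (hβ : 0 < β) (ht : 0 < t) :
    IntervalIntegrable (fun s => fracKernel β (t - s) * fracKernel α s) volume 0 t := by
  by_contra h
  have := integral_fracKernel_mul_fracKernel hα hβ ht
  rw [intervalIntegral.integral_undef h] at this
  exact (fracKernel_pos (add_pos hα hβ) ht).ne this

end FracKernel

section MLKernel

variable {δ ξ ρ β t : ℝ}

theorem mlKernel_one (t : ℝ) : mlKernel δ ξ 1 t = mittagLeffler δ (-ξ * t ^ δ) := by
  simp [mlKernel, mittagLeffler]

theorem hasSum_mlKernel (hδ : 0 < δ) (hρ : 0 < ρ) (ht : 0 < t) :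
    HasSum (fun k : ℕ => (-ξ) ^ k * fracKernel (δ * k + ρ) t) (mlKernel δ ξ ρ t) := by
  refine ((summable_mittagLeffler₂ hδ hρ (-ξ * t ^ δ)).hasSum.mul_left (t ^ (ρ - 1))).congr_fun
    fun k => ?_
  rw [fracKernel, mul_pow, ← Real.rpow_natCast (t ^ δ) k, ← Real.rpow_mul ht.le,
    show δ * k + ρ - 1 = (ρ - 1) + δ * k by ring, Real.rpow_add ht]
  ring

theorem mlKernel_eq_sub (hδ : 0 < δ) (hρ : 0 < ρ) (ht : 0 < t) :
    mlKernel δ ξ ρ t = fracKernel ρ t - ξ * mlKernel δ ξ (ρ + δ) t := by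
  rw [mlKernel, mittagLeffler₂_eq_add hδ hρ, mlKernel, fracKernel,
    show ρ + δ - 1 = (ρ - 1) + δ by ring, Real.rpow_add ht]
  ring

theorem integral_norm_fracKernel_mul_fracKernel (hρ : 0 < ρ) (hβ : 0 < β) (ht : 0 < t) :
    ∫ s in Ioc 0 t, ‖fracKernel β (t - s) * fracKernel ρ s‖ = ‖fracKernel (ρ + β) t‖ := by
  have hnorm : ∀ s ∈ Ioc 0 t, ‖fracKernel β (t - s) * fracKernel ρ s‖
      = fracKernel β (t - s) * fracKernel ρ s := fun s hs =>
    Real.norm_of_nonneg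
      (mul_nonneg (fracKernel_nonneg hβ (sub_nonneg.2 hs.2)) (fracKernel_nonneg hρ hs.1.le))
  rw [setIntegral_congr_fun measurableSet_Ioc hnorm, ← intervalIntegral.integral_of_le ht.le,
    integral_fracKernel_mul_fracKernel hρ hβ ht,
    Real.norm_of_nonneg (fracKernel_nonneg (add_pos hρ hβ) ht.le)]

theorem integral_fracKernel_mul_mlKernel (hδ : 0 < δ) (hρ : 0 < ρ) (hβ : 0 < β) (ht : 0 < t) :
    ∫ s in (0 : ℝ)..t, fracKernel β (t - s) * mlKernel δ ξ ρ s = mlKernel δ ξ (ρ + β) t := by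
  have hρk : ∀ k : ℕ, 0 < δ * k + ρ := fun k => by positivity
  let term : ℕ → ℝ → ℝ := fun k s => (-ξ) ^ k * (fracKernel β (t - s) * fracKernel (δ * k + ρ) s)
  have hterm : ∀ k, IntegrableOn (term k) (Ioc 0 t) := fun k =>
    ((intervalIntegrable_iff_integrableOn_Ioc_of_le ht.le).1
      (intervalIntegrable_fracKernel_mul (hρk k) hβ ht)).const_mul _
  have hsum := hasSum_mlKernel (ξ := ξ) hδ (add_pos hρ hβ) ht
  have hval : ∀ k, ∫ s in Ioc 0 t, term k s = (-ξ) ^ k * fracKernel (δ * k + (ρ + β)) t :=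
    fun k => by
      rw [integral_const_mul, ← intervalIntegral.integral_of_le ht.le,
        integral_fracKernel_mul_fracKernel (hρk k) hβ ht, add_assoc]
  have hnorm : ∀ k, ∫ s in Ioc 0 t, ‖term k s‖
      = ‖(-ξ) ^ k * fracKernel (δ * k + (ρ + β)) t‖ := fun k => by
    simp only [term, norm_mul ((-ξ) ^ k)]
    rw [integral_const_mul, integral_norm_fracKernel_mul_fracKernel (hρk k) hβ ht, add_assoc]
  have hpointwise : ∀ s ∈ Ioc 0 t, fracKernel β (t - s) * mlKernel δ ξ ρ s = ∑' k, term k s :=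
    fun s hs => (((hasSum_mlKernel hδ hρ hs.1).mul_left (fracKernel β (t - s))).congr_fun
      fun k => mul_left_comm _ _ _).tsum_eq.symm
  have hswap := hasSum_integral_of_summable_integral_norm hterm
    (by simp only [hnorm]; exact hsum.summable.norm)
  simp only [hval] at hswap
  rw [intervalIntegral.integral_of_le ht.le, setIntegral_congr_fun measurableSet_Ioc hpointwise]
  exact hswap.unique hsum

theorem continuous_mittagLeffler₂_rpow (hδ : 0 < δ) (hρ : 0 < ρ) :
    Continuous fun t : ℝ => mittagLeffler₂ δ ρ (-ξ * t ^ δ) :=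
  (continuous_mittagLeffler₂ hδ hρ).comp (continuous_const.mul (Real.continuous_rpow_const hδ.le))

theorem continuous_mlKernel_one (hδ : 0 < δ) : Continuous (mlKernel δ ξ 1) :=
  (continuous_mittagLeffler₂_rpow (ξ := ξ) hδ one_pos).congr fun t => by simp [mlKernel]

theorem continuousOn_mlKernel (hδ : 0 < δ) (hρ : 0 < ρ) :
    ContinuousOn (mlKernel δ ξ ρ) (Ioi 0) :=
  (continuousOn_id.rpow_const fun _ ht => Or.inl (ne_of_gt ht)).mul
    (continuous_mittagLeffler₂_rpow hδ hρ).continuousOn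

theorem intervalIntegrable_mlKernel (hδ : 0 < δ) (hρ : 0 < ρ) (a b : ℝ) :
    IntervalIntegrable (mlKernel δ ξ ρ) volume a b :=
  (intervalIntegral.intervalIntegrable_rpow' (by linarith)).mul_continuousOn
    (continuous_mittagLeffler₂_rpow hδ hρ).continuousOn

theorem intervalIntegrable_fracKernel_mul_mlKernel (hδ : 0 < δ) (hρ : 0 < ρ)
    (hβ : 0 < β) (ht : 0 < t) :
    IntervalIntegrable (fun s => fracKernel β (t - s) * mlKernel δ ξ ρ s) volume 0 t := by
  refine (((intervalIntegrable_fracKernel_mul hρ hβ ht).mul_const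
    (Real.Gamma ρ)).mul_continuousOn
      (continuous_mittagLeffler₂_rpow (ξ := ξ) hδ hρ).continuousOn).congr fun s _ => ?_
  have hΓ := (Real.Gamma_pos_of_pos hρ).ne'
  simp only [fracKernel, mlKernel]
  field_simp

end MLKernel

/-! ### Positivity of the resolvent kernel -/

theorem lt_of_forall_first_time {f g : ℝ → ℝ} (hf : ContinuousOn f (Ici 0))
    (hg : ContinuousOn g (Ici 0)) (h0 : f 0 < g 0)
    (hstep : ∀ T > 0, (∀ s ∈ Ico 0 T, f s < g s) → f T < g T) {t : ℝ} (ht : 0 ≤ t) :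
    f t < g t := by
  by_contra hcross
  have hclosed : IsClosed {s ∈ Icc 0 t | g s ≤ f s} :=
    isClosed_Icc.isClosed_le (hg.mono Icc_subset_Ici_self) (hf.mono Icc_subset_Ici_self)
  obtain ⟨T, ⟨hT, hgf⟩, hfirst⟩ :=
    (isCompact_Icc.of_isClosed_subset hclosed (sep_subset _ _)).exists_isLeast
      ⟨t, ⟨ht, le_rfl⟩, not_lt.1 hcross⟩
  have hTpos : 0 < T := hT.1.lt_of_ne fun h => (h ▸ hgf).not_gt h0
  refine (hstep T hTpos fun s hs => not_le.1 fun hs' => ?_).not_ge hgf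
  exact (hfirst ⟨⟨hs.1, hs.2.le.trans hT.2⟩, hs'⟩).not_gt hs.2

section Positivity

variable {α δ ξ : ℝ}

theorem fracKernel_antitoneOn (hα : 0 < α) (hα1 : α ≤ 1) : AntitoneOn (fracKernel α) (Ioi 0) :=
  fun _ hs _ _ hst => div_le_div_of_nonneg_right
    (Real.rpow_le_rpow_of_nonpos hs hst (sub_nonpos.2 hα1)) (Real.Gamma_pos_of_pos hα).le

theorem fracKernel_mul_fracKernel_add_le (hα1 : α ≤ 1) {x y h : ℝ} (hx : 0 < x) (hxy : x ≤ y)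
    (hh : 0 ≤ h) :
    fracKernel α y * fracKernel α (x + h) ≤ fracKernel α x * fracKernel α (y + h) := by
  have hy : 0 < y := hx.trans_le hxy
  have hmul : x * (y + h) ≤ y * (x + h) := by nlinarith
  have hpow := Real.rpow_le_rpow_of_nonpos (by positivity) hmul (sub_nonpos.2 hα1)
  rw [Real.mul_rpow hy.le (by positivity), Real.mul_rpow hx.le (by positivity)] at hpow
  simp only [fracKernel, div_mul_div_comm]
  exact div_le_div_of_nonneg_right hpow (mul_self_nonneg _)

theorem integral_fracKernel_sub (hα : 0 < α) {t T : ℝ} :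
    ∫ s in t..T, fracKernel α (T - s) = fracKernel (α + 1) (T - t) := by
  rw [intervalIntegral.integral_comp_sub_left, sub_self]
  simp only [fracKernel]
  rw [intervalIntegral.integral_div, integral_rpow (Or.inl (by linarith)), sub_add_cancel,
    Real.zero_rpow hα.ne', sub_zero, add_sub_cancel_right, Real.Gamma_add_one hα.ne', div_div]

/-- Log-convexity of the fractional kernel turns `mlKernel δ ξ δ T ≤ 0` into a backward Volterra
inequality. -/
theorem mlKernel_mul_fracKernel_le_of_nonpos (hδ : 0 < δ) (hδ1 : δ ≤ 1) (hξ : 0 ≤ ξ) {t T : ℝ}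
    (ht : 0 < t) (htT : t < T) (hpos : ∀ s ∈ Ioo 0 T, 0 ≤ mlKernel δ ξ δ s)
    (hT : mlKernel δ ξ δ T ≤ 0) :
    fracKernel δ T * mlKernel δ ξ δ t
      ≤ ξ * fracKernel δ t * ∫ s in t..T, fracKernel δ (T - s) * mlKernel δ ξ δ s := by
  have hTpos := ht.trans htT
  have hvolterra : ∀ τ > 0, mlKernel δ ξ δ τ
      = fracKernel δ τ - ξ * ∫ s in (0 : ℝ)..τ, fracKernel δ (τ - s) * mlKernel δ ξ δ s :=
    fun τ hτ => by rw [integral_fracKernel_mul_mlKernel hδ hδ hδ hτ, ← mlKernel_eq_sub hδ hδ hτ]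
  have hint := intervalIntegrable_fracKernel_mul_mlKernel (ξ := ξ) hδ hδ hδ hTpos
  have hsplit := intervalIntegral.integral_add_adjacent_intervals
    (hint.mono_set (uIcc_subset_uIcc_left (mem_uIcc_of_le ht.le htT.le)))
    (hint.mono_set (uIcc_subset_uIcc_right (mem_uIcc_of_le ht.le htT.le)))
  have hmono : fracKernel δ t * ∫ s in (0 : ℝ)..t, fracKernel δ (T - s) * mlKernel δ ξ δ s
      ≤ fracKernel δ T * ∫ s in (0 : ℝ)..t, fracKernel δ (t - s) * mlKernel δ ξ δ s := by
    rw [← intervalIntegral.integral_const_mul, ← intervalIntegral.integral_const_mul]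
    refine intervalIntegral.integral_mono_on_of_le_Ioo ht.le
      ((hint.mono_set (uIcc_subset_uIcc_left (mem_uIcc_of_le ht.le htT.le))).const_mul _)
      ((intervalIntegrable_fracKernel_mul_mlKernel hδ hδ hδ ht).const_mul _) fun s hs => ?_
    have hlog := fracKernel_mul_fracKernel_add_le hδ1 (sub_pos.2 hs.2)
      (sub_le_sub_right htT.le s) hs.1.le
    rw [sub_add_cancel, sub_add_cancel] at hlog
    nlinarith [mul_le_mul_of_nonneg_right hlog (hpos s ⟨hs.1, hs.2.trans htT⟩)]
  rw [hvolterra T hTpos, ← hsplit] at hT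
  rw [hvolterra t ht]
  nlinarith [mul_le_mul_of_nonneg_left hmono hξ,
    mul_le_mul_of_nonneg_left hT (fracKernel_nonneg hδ ht.le)]

theorem nonpos_of_le_integral_fracKernel {K t₁ T : ℝ} {f : ℝ → ℝ} (hα : 0 < α) (hK : 0 ≤ K)
    (ht₁ : t₁ < T) (hf : ContinuousOn f (Icc t₁ T)) (hT : f T ≤ 0)
    (hsmall : K * fracKernel (α + 1) (T - t₁) < 1)
    (hvolterra : ∀ t ∈ Ico t₁ T, f t ≤ K * ∫ s in t..T, fracKernel α (T - s) * f s) :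
    f t₁ ≤ 0 := by
  by_contra! hpos
  obtain ⟨m, hm, hmax⟩ := isCompact_Icc.exists_isMaxOn (nonempty_Icc.2 ht₁.le) hf
  have hmpos : 0 < f m := hpos.trans_le (hmax (left_mem_Icc.2 ht₁.le))
  have hmT : m < T := hm.2.lt_of_ne fun h => hT.not_gt (h ▸ hmpos)
  have hκ : IntervalIntegrable (fun s => fracKernel α (T - s)) volume m T := by
    simpa only [sub_sub_cancel] using
      (intervalIntegrable_fracKernel hα (T - m) (T - T)).comp_sub_left T
  have hintegral : ∫ s in m..T, fracKernel α (T - s) * f s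
      ≤ fracKernel (α + 1) (T - t₁) * f m := by
    calc ∫ s in m..T, fracKernel α (T - s) * f s
        ≤ ∫ s in m..T, fracKernel α (T - s) * f m :=
          intervalIntegral.integral_mono_on hmT.le
            (hκ.mul_continuousOn (uIcc_of_le hmT.le ▸ hf.mono (Icc_subset_Icc_left hm.1)))
            (hκ.mul_const _) fun s hs => mul_le_mul_of_nonneg_left
              (hmax (Icc_subset_Icc_left hm.1 hs)) (fracKernel_nonneg hα (sub_nonneg.2 hs.2))
      _ = fracKernel (α + 1) (T - m) * f m := by
          rw [intervalIntegral.integral_mul_const, integral_fracKernel_sub hα]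
      _ ≤ fracKernel (α + 1) (T - t₁) * f m := by
          refine mul_le_mul_of_nonneg_right (div_le_div_of_nonneg_right ?_
            (Real.Gamma_pos_of_pos (by linarith)).le) hmpos.le
          exact Real.rpow_le_rpow (by linarith) (by linarith [hm.1]) (by linarith)
  nlinarith [hvolterra m ⟨hm.1, hmT⟩, mul_le_mul_of_nonneg_left hintegral hK]

theorem exists_mul_fracKernel_sub_lt_one (hα : 0 < α) (K : ℝ) {t₀ T : ℝ} (h : t₀ < T) :
    ∃ t₁ ∈ Ioo t₀ T, K * fracKernel (α + 1) (T - t₁) < 1 := by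
  have hcont : Continuous fun t => K * fracKernel (α + 1) (T - t) :=
    continuous_const.mul (((Real.continuous_rpow_const (by linarith)).comp
      (continuous_const.sub continuous_id)).div_const _)
  have hzero : K * fracKernel (α + 1) (T - T) < 1 := by
    simp [fracKernel, Real.zero_rpow hα.ne']
  have hleft : ∀ᶠ t in 𝓝[<] T, t ∈ Ioo t₀ T := Ioo_mem_nhdsLT h
  exact (hleft.and (nhdsWithin_le_nhds
    (hcont.continuousAt.eventually_lt_const hzero))).exists

theorem mlKernel_pos_of_forall_Ioo (hδ : 0 < δ) (hδ1 : δ ≤ 1) (hξ : 0 ≤ ξ) {T : ℝ} (hT : 0 < T)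
    (hpos : ∀ s ∈ Ioo 0 T, 0 < mlKernel δ ξ δ s) : 0 < mlKernel δ ξ δ T := by
  by_contra! hneg
  have hκT := fracKernel_pos hδ hT
  have hκ2 := fracKernel_nonneg hδ (half_pos hT).le
  obtain ⟨t₁, ht₁, hsmall⟩ := exists_mul_fracKernel_sub_lt_one hδ
    (ξ * fracKernel δ (T / 2) / fracKernel δ T) (half_lt_self hT)
  have ht₁pos : 0 < t₁ := (half_pos hT).trans ht₁.1
  refine (hpos t₁ ⟨ht₁pos, ht₁.2⟩).not_ge (nonpos_of_le_integral_fracKernel hδ (by positivity)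
    ht₁.2 ((continuousOn_mlKernel hδ hδ).mono fun s hs => ht₁pos.trans_le hs.1) hneg hsmall
    fun t ht => ?_)
  have ht0 : 0 < t := ht₁pos.trans_le ht.1
  have hintegral : 0 ≤ ∫ s in t..T, fracKernel δ (T - s) * mlKernel δ ξ δ s := by
    rw [intervalIntegral.integral_of_le ht.2.le, integral_Ioc_eq_integral_Ioo]
    exact setIntegral_nonneg measurableSet_Ioo fun s hs =>
      mul_nonneg (fracKernel_nonneg hδ (sub_nonneg.2 hs.2.le))
        (hpos s ⟨ht0.trans hs.1, hs.2⟩).le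
  have hκ : fracKernel δ t ≤ fracKernel δ (T / 2) :=
    fracKernel_antitoneOn hδ hδ1 (half_pos hT) ht0 (ht₁.1.le.trans ht.1)
  have hvolterra := mlKernel_mul_fracKernel_le_of_nonpos hδ hδ1 hξ ht0 ht.2
    (fun s hs => (hpos s hs).le) hneg
  rw [div_mul_eq_mul_div, le_div_iff₀ hκT, mul_comm]
  exact hvolterra.trans (by gcongr)

theorem mlKernel_pos (hδ : 0 < δ) (hδ1 : δ ≤ 1) (hξ : 0 ≤ ξ) {t : ℝ} (ht : 0 < t) :
    0 < mlKernel δ ξ δ t := by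
  have hiff : ∀ s > 0, 0 < mlKernel δ ξ δ s ↔ 0 < mittagLeffler₂ δ δ (-ξ * s ^ δ) := fun s hs =>
    mul_pos_iff_of_pos_left (Real.rpow_pos_of_pos hs _)
  have h0 : 0 < mittagLeffler₂ δ δ (-ξ * 0 ^ δ) := by
    rw [Real.zero_rpow hδ.ne', mul_zero, mittagLeffler₂_zero]
    exact one_div_pos.2 (Real.Gamma_pos_of_pos hδ)
  refine (hiff t ht).2 (lt_of_forall_first_time continuousOn_const
    (continuous_mittagLeffler₂_rpow hδ hδ).continuousOn h0 (fun T hT hbefore => ?_) ht.le)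
  exact (hiff T hT).1 (mlKernel_pos_of_forall_Ioo hδ hδ1 hξ hT
    fun s hs => (hiff s hs.1).2 (hbefore s (Ioo_subset_Ico_self hs)))

end Positivity

/-! ### Two-sided bounds for the Mittag-Leffler function -/

section Bounds

variable {δ ξ t : ℝ}

theorem integral_fracKernel_one_sub_mul_mlKernel (hδ : 0 < δ) (hδ1 : δ < 1) (ht : 0 < t) :
    ∫ s in (0 : ℝ)..t, fracKernel (1 - δ) (t - s) * mlKernel δ ξ δ s = mlKernel δ ξ 1 t := by
  rw [integral_fracKernel_mul_mlKernel hδ hδ (sub_pos.2 hδ1) ht, add_sub_cancel]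

theorem mlKernel_one_eq_integral (hδ : 0 < δ) (ht : 0 ≤ t) :
    mlKernel δ ξ 1 t = 1 - ξ * ∫ s in (0 : ℝ)..t, mlKernel δ ξ δ s := by
  rcases ht.eq_or_lt with rfl | ht
  · simp [mlKernel, mittagLeffler₂_zero, Real.zero_rpow hδ.ne']
  have h := integral_fracKernel_mul_mlKernel (ξ := ξ) hδ hδ one_pos ht
  simp only [fracKernel_one, one_mul] at h
  rw [h, mlKernel_eq_sub hδ one_pos ht, fracKernel_one, add_comm δ 1]

theorem mlKernel_one_zero (hδ : 0 < δ) : mlKernel δ ξ 1 0 = 1 := by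
  simpa using mlKernel_one_eq_integral (ξ := ξ) hδ le_rfl

theorem mlKernel_one_antitoneOn (hδ : 0 < δ) (hδ1 : δ ≤ 1) (hξ : 0 ≤ ξ) :
    AntitoneOn (mlKernel δ ξ 1) (Ici 0) := by
  intro s hs t ht hst
  have hint := intervalIntegrable_mlKernel (ξ := ξ) hδ hδ
  have hnonneg : 0 ≤ ∫ τ in s..t, mlKernel δ ξ δ τ := by
    rw [intervalIntegral.integral_of_le hst]
    exact setIntegral_nonneg measurableSet_Ioc fun τ hτ =>
      (mlKernel_pos hδ hδ1 hξ (lt_of_le_of_lt hs hτ.1)).le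
  rw [mlKernel_one_eq_integral hδ hs, mlKernel_one_eq_integral hδ ht,
    ← intervalIntegral.integral_add_adjacent_intervals (hint 0 s) (hint s t), mul_add]
  linarith [mul_nonneg hξ hnonneg]

theorem mlKernel_one_le_one (hδ : 0 < δ) (hδ1 : δ ≤ 1) (hξ : 0 ≤ ξ) (ht : 0 ≤ t) :
    mlKernel δ ξ 1 t ≤ 1 :=
  (mlKernel_one_antitoneOn hδ hδ1 hξ self_mem_Ici ht ht).trans_eq (mlKernel_one_zero hδ)

theorem one_le_mlKernel_one_mul (hδ : 0 < δ) (hδ1 : δ < 1) (hξ : 0 ≤ ξ) (ht : 0 ≤ t) :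
    1 ≤ mlKernel δ ξ 1 t * (1 + ξ * Real.Gamma (1 - δ) * t ^ δ) := by
  rcases ht.eq_or_lt with rfl | ht
  · simp [mlKernel_one_zero hδ, Real.zero_rpow hδ.ne']
  have hδ' : 0 < 1 - δ := sub_pos.2 hδ1
  have : 0 < Real.Gamma (1 - δ) := Real.Gamma_pos_of_pos hδ'
  have : 0 < t ^ δ := Real.rpow_pos_of_pos ht _
  have hmono : fracKernel (1 - δ) t * ∫ s in (0 : ℝ)..t, mlKernel δ ξ δ s
      ≤ mlKernel δ ξ 1 t := by
    rw [← integral_fracKernel_one_sub_mul_mlKernel hδ hδ1 ht,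
      ← intervalIntegral.integral_const_mul]
    refine intervalIntegral.integral_mono_on_of_le_Ioo ht.le
      ((intervalIntegrable_mlKernel hδ hδ 0 t).const_mul _)
      (intervalIntegrable_fracKernel_mul_mlKernel hδ hδ hδ' ht) fun s hs => ?_
    exact mul_le_mul_of_nonneg_right (fracKernel_antitoneOn hδ' (by linarith) (sub_pos.2 hs.2) ht
      (sub_le_self t hs.1.le)) (mlKernel_pos hδ hδ1.le hξ hs.1).le
  rw [fracKernel, show 1 - δ - 1 = -δ by ring, Real.rpow_neg ht.le, inv_div_left,
    inv_mul_le_iff₀ (by positivity)] at hmono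
  nlinarith [mul_le_mul_of_nonneg_left hmono hξ, mlKernel_one_eq_integral (ξ := ξ) hδ ht.le]

theorem mlKernel_one_pos (hδ : 0 < δ) (hδ1 : δ < 1) (hξ : 0 ≤ ξ) (ht : 0 ≤ t) :
    0 < mlKernel δ ξ 1 t := by
  have : 0 < Real.Gamma (1 - δ) := Real.Gamma_pos_of_pos (sub_pos.2 hδ1)
  have := Real.rpow_nonneg ht δ
  exact pos_of_mul_pos_left (one_pos.trans_le (one_le_mlKernel_one_mul hδ hδ1 hξ ht))
    (by positivity)

theorem mul_rpow_mul_mlKernel_one_le (hδ : 0 < δ) (hδ1 : δ < 1) (hξ : 0 ≤ ξ) (ht : 0 < t) :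
    ξ * t ^ δ * mlKernel δ ξ 1 t ≤ Real.Gamma (1 + δ) := by
  have hG : 0 < Real.Gamma (1 + δ) := Real.Gamma_pos_of_pos (by linarith)
  have hmono : fracKernel (1 + δ) t * mlKernel δ ξ 1 t ≤ mlKernel δ ξ (1 + δ) t := by
    rw [← integral_fracKernel_mul_fracKernel one_pos hδ ht,
      ← integral_fracKernel_mul_mlKernel hδ one_pos hδ ht, ← intervalIntegral.integral_mul_const]
    refine intervalIntegral.integral_mono_on_of_le_Ioo ht.le
      ((intervalIntegrable_fracKernel_mul one_pos hδ ht).mul_const _)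
      (intervalIntegrable_fracKernel_mul_mlKernel hδ one_pos hδ ht) fun s hs => ?_
    rw [fracKernel_one, mul_one]
    exact mul_le_mul_of_nonneg_left (mlKernel_one_antitoneOn hδ hδ1.le hξ hs.1.le ht.le hs.2.le)
      (fracKernel_nonneg hδ (sub_nonneg.2 hs.2.le))
  have hsub := mlKernel_eq_sub (ξ := ξ) hδ one_pos ht
  rw [fracKernel_one] at hsub
  have hle : ξ * (fracKernel (1 + δ) t * mlKernel δ ξ 1 t) ≤ 1 := by
    linarith [mul_le_mul_of_nonneg_left hmono hξ, mlKernel_one_pos hδ hδ1 hξ ht.le]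
  rw [fracKernel, add_sub_cancel_left, div_mul_eq_mul_div, mul_div_assoc', div_le_one hG] at hle
  linarith

theorem integral_mlKernel_mul_mlKernel_one_le (hδ : 0 < δ) (hδ1 : δ < 1) (hξ : 0 < ξ)
    (ht : 0 < t) :
    ∫ s in (0 : ℝ)..t, mlKernel δ ξ δ (t - s) * mlKernel δ ξ 1 s
      ≤ Real.Gamma (1 + δ) * Real.Gamma (1 - δ) / ξ * mlKernel δ ξ 1 t := by
  have hδ' : 0 < 1 - δ := sub_pos.2 hδ1
  have : 0 < Real.Gamma (1 - δ) := Real.Gamma_pos_of_pos hδ'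
  have hcomm : ∫ s in (0 : ℝ)..t, mlKernel δ ξ δ (t - s) * mlKernel δ ξ 1 s
      = ∫ s in (0 : ℝ)..t, mlKernel δ ξ 1 (t - s) * mlKernel δ ξ δ s := by
    simpa [mul_comm] using intervalIntegral.integral_comp_sub_left (a := 0) (b := t)
      (fun s => mlKernel δ ξ 1 (t - s) * mlKernel δ ξ δ s) t
  rw [hcomm, ← integral_fracKernel_one_sub_mul_mlKernel hδ hδ1 ht,
    ← intervalIntegral.integral_const_mul]
  refine intervalIntegral.integral_mono_on_of_le_Ioo ht.le
    ((intervalIntegrable_mlKernel hδ hδ 0 t).continuousOn_mul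
      ((continuous_mlKernel_one hδ).comp (continuous_const.sub continuous_id)).continuousOn)
    ((intervalIntegrable_fracKernel_mul_mlKernel hδ hδ hδ' ht).const_mul _) fun s hs => ?_
  have hts : 0 < t - s := sub_pos.2 hs.2
  have := Real.rpow_pos_of_pos hts δ
  rw [← mul_assoc]
  refine mul_le_mul_of_nonneg_right ?_ (mlKernel_pos hδ hδ1.le hξ.le hs.1).le
  calc mlKernel δ ξ 1 (t - s) ≤ Real.Gamma (1 + δ) / (ξ * (t - s) ^ δ) :=
        (le_div_iff₀' (by positivity)).2 (mul_rpow_mul_mlKernel_one_le hδ hδ1 hξ.le hts)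
    _ = Real.Gamma (1 + δ) * Real.Gamma (1 - δ) / ξ * fracKernel (1 - δ) (t - s) := by
        rw [fracKernel, show 1 - δ - 1 = -δ by ring, Real.rpow_neg hts.le]
        field_simp

end Bounds

/-! ### The Mittag-Leffler decay function -/

section Decay

variable {δ ξ : ℝ}

theorem mlDecay_eq (t : ℝ) : mlDecay δ ξ t = mlKernel δ ξ 1 (max t 0) := by
  rw [mlKernel_one, mlDecay]

theorem mlDecay_of_nonneg {t : ℝ} (ht : 0 ≤ t) : mlDecay δ ξ t = mlKernel δ ξ 1 t := by
  rw [mlDecay_eq, max_eq_left ht]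

theorem mlDecay_of_nonpos (hδ : 0 < δ) {t : ℝ} (ht : t ≤ 0) : mlDecay δ ξ t = 1 := by
  rw [mlDecay_eq, max_eq_right ht, mlKernel_one_zero hδ]

theorem mlDecay_pos (hδ : 0 < δ) (hδ1 : δ < 1) (hξ : 0 ≤ ξ) (t : ℝ) : 0 < mlDecay δ ξ t :=
  mlDecay_eq (δ := δ) t ▸ mlKernel_one_pos hδ hδ1 hξ (le_max_right _ _)

theorem mlDecay_le_one (hδ : 0 < δ) (hδ1 : δ ≤ 1) (hξ : 0 ≤ ξ) (t : ℝ) : mlDecay δ ξ t ≤ 1 :=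
  mlDecay_eq (δ := δ) t ▸ mlKernel_one_le_one hδ hδ1 hξ (le_max_right _ _)

theorem continuous_mlDecay (hδ : 0 < δ) : Continuous (mlDecay δ ξ) := by
  rw [funext mlDecay_eq]
  exact (continuous_mlKernel_one hδ).comp (continuous_id.max continuous_const)

theorem mlDecay_sub_le_of_le_two_mul (hδ : 0 < δ) (hδ1 : δ < 1) (hξ : 0 ≤ ξ) {μ t : ℝ}
    (ht : 0 ≤ t) (htμ : t ≤ 2 * μ) :
    mlDecay δ ξ (t - μ) ≤ (1 + ξ * Real.Gamma (1 - δ) * (2 * μ) ^ δ) * mlDecay δ ξ t := by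
  have : 0 < Real.Gamma (1 - δ) := Real.Gamma_pos_of_pos (sub_pos.2 hδ1)
  have hpos := mlKernel_one_pos hδ hδ1 hξ ht
  calc mlDecay δ ξ (t - μ) ≤ 1 := mlDecay_le_one hδ hδ1.le hξ _
    _ ≤ (1 + ξ * Real.Gamma (1 - δ) * t ^ δ) * mlKernel δ ξ 1 t := by
        simpa only [mul_comm] using one_le_mlKernel_one_mul hδ hδ1 hξ ht
    _ ≤ (1 + ξ * Real.Gamma (1 - δ) * (2 * μ) ^ δ) * mlDecay δ ξ t := by
        rw [mlDecay_of_nonneg ht]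
        gcongr

theorem Gamma_one_add_le_one (hδ : 0 ≤ δ) (hδ1 : δ ≤ 1) : Real.Gamma (1 + δ) ≤ 1 := by
  have hconvex := Real.convexOn_Gamma.2 (mem_Ioi.2 one_pos) (mem_Ioi.2 two_pos)
    (sub_nonneg.2 hδ1) hδ (sub_add_cancel 1 δ)
  simp only [smul_eq_mul, Real.Gamma_one, Real.Gamma_two] at hconvex
  rw [show (1 - δ) * 1 + δ * 2 = 1 + δ by ring] at hconvex
  linarith

theorem mlDecay_sub_le_of_two_mul_le (hδ : 0 < δ) (hδ1 : δ < 1) (hξ : 0 < ξ) {μ t : ℝ}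
    (hμ : 0 < μ) (hμt : 2 * μ ≤ t) :
    mlDecay δ ξ (t - μ)
      ≤ (1 / (ξ * μ ^ δ) + 2 ^ δ * Real.Gamma (1 - δ)) * mlDecay δ ξ t := by
  have ht : 0 < t := by linarith
  have htμ : 0 < t - μ := by linarith
  have : 0 < t ^ δ := Real.rpow_pos_of_pos ht _
  have : 0 < μ ^ δ := Real.rpow_pos_of_pos hμ _
  have hpos := mlKernel_one_pos hδ hδ1 hξ.le ht.le
  have hupper : ξ * (t - μ) ^ δ * mlKernel δ ξ 1 (t - μ) ≤ 1 :=
    (mul_rpow_mul_mlKernel_one_le hδ hδ1 hξ.le htμ).trans (Gamma_one_add_le_one hδ.le hδ1.le)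
  have hhalf : t ^ δ ≤ 2 ^ δ * (t - μ) ^ δ := by
    rw [← Real.mul_rpow zero_le_two htμ.le]
    exact Real.rpow_le_rpow ht.le (by linarith) hδ.le
  have hdouble : 2 ^ δ * μ ^ δ ≤ t ^ δ := by
    rw [← Real.mul_rpow zero_le_two hμ.le]
    exact Real.rpow_le_rpow (by positivity) hμt hδ.le
  rw [mlDecay_of_nonneg htμ.le, mlDecay_of_nonneg ht.le]
  calc mlKernel δ ξ 1 (t - μ) ≤ 2 ^ δ / (ξ * t ^ δ) := by
        rw [le_div_iff₀ (by positivity)]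
        have := mul_le_mul_of_nonneg_left hhalf
          (mul_nonneg hξ.le (mlKernel_one_pos hδ hδ1 hξ.le htμ.le).le)
        nlinarith [Real.rpow_pos_of_pos two_pos δ]
    _ ≤ 2 ^ δ / (ξ * t ^ δ) * (mlKernel δ ξ 1 t * (1 + ξ * Real.Gamma (1 - δ) * t ^ δ)) :=
        le_mul_of_one_le_right (by positivity) (one_le_mlKernel_one_mul hδ hδ1 hξ.le ht.le)
    _ = (2 ^ δ / (ξ * t ^ δ) + 2 ^ δ * Real.Gamma (1 - δ)) * mlKernel δ ξ 1 t := by field_simp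
    _ ≤ (1 / (ξ * μ ^ δ) + 2 ^ δ * Real.Gamma (1 - δ)) * mlKernel δ ξ 1 t := by
        have hle : 2 ^ δ / (ξ * t ^ δ) ≤ 1 / (ξ * μ ^ δ) := by
          rw [div_le_div_iff₀ (by positivity) (by positivity)]
          nlinarith
        gcongr

theorem mlDecay_sub_le (hδ : 0 < δ) (hδ1 : δ < 1) (hξ : 0 < ξ) {μ t : ℝ} (hμ : 0 < μ)
    (ht : 0 ≤ t) :
    mlDecay δ ξ (t - μ) ≤ max (1 + ξ * Real.Gamma (1 - δ) * (2 * μ) ^ δ)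
      (1 / (ξ * μ ^ δ) + 2 ^ δ * Real.Gamma (1 - δ)) * mlDecay δ ξ t := by
  have hpos := (mlDecay_pos hδ hδ1 hξ.le t).le
  rcases le_total t (2 * μ) with h | h
  · exact (mlDecay_sub_le_of_le_two_mul hδ hδ1 hξ.le ht h).trans
      (mul_le_mul_of_nonneg_right (le_max_left _ _) hpos)
  · exact (mlDecay_sub_le_of_two_mul_le hδ hδ1 hξ hμ h).trans
      (mul_le_mul_of_nonneg_right (le_max_right _ _) hpos)

end Decay

/-! ### Convolution of causal functions -/

/-- Functions on the half-line, extended by zero, that are integrable up to any time; on them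
convolution is defined almost everywhere, commutative and associative. -/
structure Causal (f : ℝ → ℝ) : Prop where
  integrableOn : ∀ T, IntegrableOn f (Iic T)
  zero : ∀ t ≤ 0, f t = 0

/-- Convolution of real functions on the line, with the junk value `0` where the integral
diverges. -/
noncomputable def realConv (f g : ℝ → ℝ) : ℝ → ℝ :=
  convolution f g (ContinuousLinearMap.mul ℝ ℝ) volume

theorem realConv_apply (f g : ℝ → ℝ) (x : ℝ) : realConv f g x = ∫ s, f s * g (x - s) := rfl

theorem realConv_comm (f g : ℝ → ℝ) : realConv f g = realConv g f := by
  funext x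
  rw [realConv, convolution_eq_swap, realConv_apply]
  exact integral_congr_ae (Eventually.of_forall fun s => mul_comm _ _)

theorem realConv_congr_right (f : ℝ → ℝ) {g g' : ℝ → ℝ} (hg : g =ᵐ[volume] g') :
    realConv f g = realConv f g' :=
  convolution_congr _ (ae_eq_refl f) hg

theorem realConv_smul (f : ℝ → ℝ) (c : ℝ) (g : ℝ → ℝ) :
    realConv f (c • g) = c • realConv f g :=
  convolution_smul

namespace Causal

variable {f g h : ℝ → ℝ}

theorem aestronglyMeasurable (hf : Causal f) : AEStronglyMeasurable f volume := by
  have hcover : (⋃ n : ℕ, Iic (n : ℝ)) = univ :=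
    eq_univ_of_forall fun x => mem_iUnion.2 (exists_nat_ge x)
  rw [← Measure.restrict_univ (μ := volume), ← hcover, aestronglyMeasurable_iUnion_iff]
  exact fun n => (hf.integrableOn n).aestronglyMeasurable

theorem congr (hf : Causal f) (hfg : f =ᵐ[volume] g) (hg : ∀ t ≤ 0, g t = 0) : Causal g :=
  ⟨fun T => (hf.integrableOn T).congr_fun_ae (ae_restrict_of_ae hfg), hg⟩

theorem add (hf : Causal f) (hg : Causal g) : Causal (f + g) :=
  ⟨fun T => (hf.integrableOn T).add (hg.integrableOn T), fun t ht => by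
    simp [hf.zero t ht, hg.zero t ht]⟩

theorem const_smul (hf : Causal f) (c : ℝ) : Causal (c • f) :=
  ⟨fun T => (hf.integrableOn T).smul c, fun t ht => by simp [hf.zero t ht]⟩

theorem norm (hf : Causal f) : Causal fun t => ‖f t‖ :=
  ⟨fun T => (hf.integrableOn T).norm, fun t ht => by simp [hf.zero t ht]⟩

theorem indicator_mul_indicator (hf : Causal f) (hg : Causal g) {x T : ℝ} (hx : x ≤ T) (s : ℝ) :
    (Iic T).indicator f s * (Iic T).indicator g (x - s) = f s * g (x - s) := by
  rcases lt_or_ge T s with hs | hs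
  · simp [hg.zero (x - s) (by linarith), hs]
  rcases lt_or_ge T (x - s) with hxs | hxs
  · simp [hf.zero s (by linarith)]
  · rw [indicator_of_mem (mem_Iic.2 hs), indicator_of_mem (mem_Iic.2 hxs)]

theorem ae_convolutionExistsAt (hf : Causal f) (hg : Causal g) :
    ∀ᵐ x, ConvolutionExistsAt f g x (ContinuousLinearMap.mul ℝ ℝ) volume := by
  have htrunc : ∀ n : ℕ, ∀ᵐ x, ConvolutionExistsAt ((Iic (n : ℝ)).indicator f)
      ((Iic (n : ℝ)).indicator g) x (ContinuousLinearMap.mul ℝ ℝ) volume := fun n =>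
    ((hf.integrableOn n).integrable_indicator measurableSet_Iic).ae_convolution_exists _
      ((hg.integrableOn n).integrable_indicator measurableSet_Iic)
  filter_upwards [ae_all_iff.2 htrunc] with x hx
  obtain ⟨n, hn⟩ := exists_nat_ge x
  exact (hx n).congr (Eventually.of_forall (hf.indicator_mul_indicator hg hn))

theorem conv (hf : Causal f) (hg : Causal g) : Causal (realConv f g) := by
  refine ⟨fun T => ?_, fun x hx => ?_⟩
  · refine (((hf.integrableOn T).integrable_indicator measurableSet_Iic).integrable_convolution
      (ContinuousLinearMap.mul ℝ ℝ) ((hg.integrableOn T).integrable_indicator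
      measurableSet_Iic)).integrableOn.congr_fun (fun x hx => ?_) measurableSet_Iic
    exact integral_congr_ae (Eventually.of_forall (hf.indicator_mul_indicator hg hx))
  · rw [realConv_apply]
    refine integral_eq_zero_of_ae (Eventually.of_forall fun s => ?_)
    rcases le_total s 0 with hs | hs
    · simp [hf.zero s hs]
    · simp [hg.zero (x - s) (by linarith)]

theorem realConv_assoc (hf : Causal f) (hg : Causal g) (hh : Causal h) :
    realConv (realConv f g) h =ᵐ[volume] realConv f (realConv g h) := by
  filter_upwards [hf.norm.ae_convolutionExistsAt (hg.norm.conv hh.norm)] with x hx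
  exact convolution_assoc _ _ _ _ (fun a b c => mul_assoc a b c) hf.aestronglyMeasurable
    hg.aestronglyMeasurable hh.aestronglyMeasurable (hf.ae_convolutionExistsAt hg)
    (hg.norm.ae_convolutionExistsAt hh.norm) hx

theorem realConv_add_smul (hf : Causal f) (hg : Causal g) (hh : Causal h) (c : ℝ) :
    realConv f (g + c • h) =ᵐ[volume] realConv f g + c • realConv f h := by
  filter_upwards [hf.ae_convolutionExistsAt hg, hf.ae_convolutionExistsAt (hh.const_smul c)]
    with x hfg hfh
  exact (hfg.distrib_add hfh).trans (by rw [← realConv_smul]; rfl)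

theorem realConv_eq_intervalIntegral (hf : Causal f) (hg : Causal g) {x : ℝ} (hx : 0 ≤ x) :
    realConv f g x = ∫ s in (0 : ℝ)..x, f (x - s) * g s := by
  rw [realConv_comm, realConv_apply, intervalIntegral.integral_of_le hx,
    ← integral_indicator measurableSet_Ioc]
  congr 1
  funext s
  rcases le_or_gt s 0 with hs | hs
  · simp [hg.zero s hs, hs]
  rcases le_or_gt s x with hsx | hsx
  · rw [indicator_of_mem (mem_Ioc.2 ⟨hs, hsx⟩), mul_comm]
  · simp [hf.zero (x - s) (by linarith), hsx]

end Causal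

theorem causal_indicator {f : ℝ → ℝ} (hf : ∀ T > 0, IntervalIntegrable f volume 0 T) :
    Causal ((Ioi 0).indicator f) := by
  refine ⟨fun T => ?_, fun t ht => indicator_of_notMem (notMem_Ioi.2 ht) _⟩
  rw [IntegrableOn, integrable_indicator_iff measurableSet_Ioi, IntegrableOn,
    Measure.restrict_restrict measurableSet_Ioi, Ioi_inter_Iic]
  rcases le_or_gt T 0 with hT | hT
  · rw [Ioc_eq_empty (not_lt.2 hT), Measure.restrict_empty]
    exact integrable_zero_measure
  · exact (intervalIntegrable_iff_integrableOn_Ioc_of_le hT.le).1 (hf T hT)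

theorem realConv_indicator {f g : ℝ → ℝ} (hf : Causal ((Ioi 0).indicator f))
    (hg : Causal ((Ioi 0).indicator g)) {x : ℝ} (hx : 0 ≤ x) :
    realConv ((Ioi 0).indicator f) ((Ioi 0).indicator g) x
      = ∫ s in (0 : ℝ)..x, f (x - s) * g s := by
  rw [hf.realConv_eq_intervalIntegral hg hx, intervalIntegral.integral_of_le hx,
    intervalIntegral.integral_of_le hx, integral_Ioc_eq_integral_Ioo, integral_Ioc_eq_integral_Ioo]
  refine setIntegral_congr_fun measurableSet_Ioo fun s hs => ?_
  simp [indicator, hs.1, hs.2]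

theorem causal_resolvent_of_volterra {κ r Z P F : ℝ → ℝ} {a : ℝ} (hκ : Causal κ) (hr : Causal r)
    (hZ : Causal Z) (hP : Causal P) (hF : Causal F)
    (hres : r =ᵐ[volume] κ + (-a) • realConv κ r)
    (hvol : Z =ᵐ[volume] P + realConv κ (F + (-a) • Z)) :
    Z =ᵐ[volume] P + (-a) • realConv r P + realConv r F := by
  have hW := hF.add (hZ.const_smul (-a))
  have hrW := hr.realConv_add_smul hF hZ (-a)
  set W := F + (-a) • Z
  have hrZ : realConv r Z =ᵐ[volume] realConv r P + (1 : ℝ) • realConv r (realConv κ W) := by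
    rw [realConv_congr_right r hvol, ← one_smul ℝ (realConv κ W)]
    simpa only [one_smul] using hr.realConv_add_smul hP (hκ.conv hW) 1
  have hκW : realConv W r =ᵐ[volume] realConv W κ + (-a) • realConv W (realConv κ r) := by
    rw [realConv_congr_right W hres]
    exact hW.realConv_add_smul hκ (hκ.conv hr) (-a)
  have hassoc : realConv W (realConv κ r) =ᵐ[volume] realConv r (realConv κ W) := by
    rw [realConv_comm W, realConv_comm κ r]
    exact hr.realConv_assoc hκ hW
  filter_upwards [hvol, hrW, hrZ, hκW, hassoc] with t h₁ h₂ h₃ h₄ h₅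
  simp only [Pi.add_apply, Pi.smul_apply, smul_eq_mul] at h₁ h₂ h₃ h₄ ⊢
  rw [realConv_comm W r, realConv_comm W κ, h₂, h₅] at h₄
  linear_combination h₁ - h₄ + (-a) * h₃

section CausalKernels

variable {δ ξ ρ β a : ℝ}

theorem causal_fracKernel (hβ : 0 < β) : Causal ((Ioi 0).indicator (fracKernel β)) :=
  causal_indicator fun _ _ => intervalIntegrable_fracKernel hβ _ _

theorem causal_mlKernel (hδ : 0 < δ) (hρ : 0 < ρ) :
    Causal ((Ioi 0).indicator (mlKernel δ ξ ρ)) :=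
  causal_indicator fun _ _ => intervalIntegrable_mlKernel hδ hρ _ _

theorem realConv_fracKernel_fracKernel (hρ : 0 < ρ) (hβ : 0 < β) :
    realConv ((Ioi 0).indicator (fracKernel β)) ((Ioi 0).indicator (fracKernel ρ))
      = (Ioi 0).indicator (fracKernel (ρ + β)) := by
  funext x
  rcases le_or_gt x 0 with hx | hx
  · rw [((causal_fracKernel hβ).conv (causal_fracKernel hρ)).zero x hx,
      (causal_fracKernel (add_pos hρ hβ)).zero x hx]
  · rw [realConv_indicator (causal_fracKernel hβ) (causal_fracKernel hρ) hx.le,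
      integral_fracKernel_mul_fracKernel hρ hβ hx, indicator_of_mem (mem_Ioi.2 hx)]

theorem realConv_fracKernel_mlKernel (hδ : 0 < δ) (hρ : 0 < ρ) (hβ : 0 < β) :
    realConv ((Ioi 0).indicator (fracKernel β)) ((Ioi 0).indicator (mlKernel δ ξ ρ))
      = (Ioi 0).indicator (mlKernel δ ξ (ρ + β)) := by
  funext x
  rcases le_or_gt x 0 with hx | hx
  · rw [((causal_fracKernel hβ).conv (causal_mlKernel hδ hρ)).zero x hx,
      (causal_mlKernel hδ (add_pos hρ hβ)).zero x hx]
  · rw [realConv_indicator (causal_fracKernel hβ) (causal_mlKernel hδ hρ) hx.le,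
      integral_fracKernel_mul_mlKernel hδ hρ hβ hx, indicator_of_mem (mem_Ioi.2 hx)]

theorem indicator_mlKernel_eq_add_realConv (hδ : 0 < δ) (hρ : 0 < ρ) :
    (Ioi 0).indicator (mlKernel δ ξ ρ) = (Ioi 0).indicator (fracKernel ρ)
      + (-ξ) • realConv ((Ioi 0).indicator (fracKernel ρ))
        ((Ioi 0).indicator (mlKernel δ ξ δ)) := by
  rw [realConv_fracKernel_mlKernel hδ hδ hρ, add_comm δ ρ]
  funext t
  rcases le_or_gt t 0 with ht | ht
  · simp [ht]
  · simp [ht, mlKernel_eq_sub hδ hρ ht, sub_eq_add_neg]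

/-! ### Monotonicity in the dissipation rate -/

theorem le_on_open_of_ae_le {f g : ℝ → ℝ} {U : Set ℝ} (hU : IsOpen U)
    (h : ∀ᵐ x, x ∈ U → f x ≤ g x) (hf : ContinuousOn f U) (hg : ContinuousOn g U) :
    ∀ x ∈ U, f x ≤ g x := by
  have hmax : f ⊔ g =ᵐ[volume.restrict U] g := by
    rw [EventuallyEq, ae_restrict_iff' hU.measurableSet]
    filter_upwards [h] with x hx hxU using sup_eq_right.2 (hx hxU)
  exact fun x hx => sup_eq_right.1 (Measure.eqOn_open_of_ae_eq hmax hU (hf.sup hg) hg hx)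

theorem mlKernel_ae_eq_add_realConv (hδ : 0 < δ) :
    (Ioi 0).indicator (mlKernel δ ξ δ) =ᵐ[volume] (Ioi 0).indicator (mlKernel δ a δ)
      + (a - ξ) • realConv ((Ioi 0).indicator (mlKernel δ a δ))
        ((Ioi 0).indicator (mlKernel δ ξ δ)) := by
  have hκ := causal_fracKernel hδ
  have hA := causal_mlKernel (ξ := a) hδ hδ
  have hX := causal_mlKernel (ξ := ξ) hδ hδ
  have hresA := indicator_mlKernel_eq_add_realConv (ξ := a) hδ hδ
  have hresX := indicator_mlKernel_eq_add_realConv (ξ := ξ) hδ hδ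
  set κ := (Ioi 0).indicator (fracKernel δ)
  set A := (Ioi 0).indicator (mlKernel δ a δ)
  set X := (Ioi 0).indicator (mlKernel δ ξ δ)
  have hvol : X = κ + realConv κ ((a - ξ) • X + (-a) • X) := by
    rwa [← add_smul, show a - ξ + -a = -ξ by ring, realConv_smul]
  have hX' := causal_resolvent_of_volterra hκ hA hX hκ (hX.const_smul (a - ξ)) hresA.eventuallyEq
    hvol.eventuallyEq
  rwa [realConv_comm A κ, ← hresA, realConv_smul] at hX'

theorem mlKernel_le_of_le (hδ : 0 < δ) (hδ1 : δ ≤ 1) (hξ : 0 ≤ ξ) (ha : ξ ≤ a) {t : ℝ}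
    (ht : 0 ≤ t) : mlKernel δ a δ t ≤ mlKernel δ ξ δ t := by
  rcases ht.eq_or_lt with rfl | ht
  · simp [mlKernel, Real.zero_rpow hδ.ne']
  refine le_on_open_of_ae_le isOpen_Ioi ?_ (continuousOn_mlKernel hδ hδ)
    (continuousOn_mlKernel hδ hδ) t ht
  filter_upwards [mlKernel_ae_eq_add_realConv (ξ := ξ) (a := a) hδ] with s hs hs0
  have hconv : 0 ≤ realConv ((Ioi 0).indicator (mlKernel δ a δ))
      ((Ioi 0).indicator (mlKernel δ ξ δ)) s :=
    integral_nonneg fun r => mul_nonneg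
      (indicator_nonneg (fun _ h => (mlKernel_pos hδ hδ1 (hξ.trans ha) h).le) _)
      (indicator_nonneg (fun _ h => (mlKernel_pos hδ hδ1 hξ h).le) _)
  simp only [Pi.add_apply, Pi.smul_apply, smul_eq_mul, indicator_of_mem hs0] at hs
  rw [hs]
  exact le_add_of_nonneg_right (mul_nonneg (sub_nonneg.2 ha) hconv)

theorem mlKernel_one_le_of_le (hδ : 0 < δ) (hδ1 : δ < 1) (hξ : 0 ≤ ξ) (ha : ξ ≤ a) {t : ℝ}
    (ht : 0 ≤ t) : mlKernel δ a 1 t ≤ mlKernel δ ξ 1 t := by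
  rcases ht.eq_or_lt with rfl | ht
  · rw [mlKernel_one_zero hδ, mlKernel_one_zero hδ]
  have hδ' : 0 < 1 - δ := sub_pos.2 hδ1
  rw [← integral_fracKernel_one_sub_mul_mlKernel hδ hδ1 ht,
    ← integral_fracKernel_one_sub_mul_mlKernel hδ hδ1 ht]
  refine intervalIntegral.integral_mono_on_of_le_Ioo ht.le
    (intervalIntegrable_fracKernel_mul_mlKernel hδ hδ hδ' ht)
    (intervalIntegrable_fracKernel_mul_mlKernel hδ hδ hδ' ht) fun s hs => ?_
  exact mul_le_mul_of_nonneg_left (mlKernel_le_of_le hδ hδ1.le hξ ha hs.1.le)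
    (fracKernel_nonneg hδ' (sub_nonneg.2 hs.2.le))

end CausalKernels

/-! ### Variation of constants for the linear Caputo equation -/

section Caputo

variable {δ a : ℝ} {z G : ℝ → ℝ}

theorem caputoDeriv_eq_realConv (hδ1 : δ < 1)
    (hz : Causal ((Ioi 0).indicator (deriv z))) {t : ℝ} (ht : 0 < t) :
    caputoDeriv δ z t
      = realConv ((Ioi 0).indicator (fracKernel (1 - δ))) ((Ioi 0).indicator (deriv z)) t := by
  rw [realConv_indicator (causal_fracKernel (sub_pos.2 hδ1)) hz ht.le, caputoDeriv,
    ← intervalIntegral.integral_const_mul]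
  congr 1
  funext w
  rw [fracKernel, show 1 - δ - 1 = -δ by ring]
  ring

theorem realConv_fracKernel_one_deriv (hz : ∀ T > 0, AbsolutelyContinuousOnInterval z 0 T) :
    realConv ((Ioi 0).indicator (fracKernel 1)) ((Ioi 0).indicator (deriv z))
      = (Ioi 0).indicator z + (-z 0) • (Ioi 0).indicator (fracKernel 1) := by
  have hD := causal_indicator fun T hT => (hz T hT).intervalIntegrable_deriv
  funext t
  rcases le_or_gt t 0 with ht | ht
  · rw [((causal_fracKernel one_pos).conv hD).zero t ht]
    simp [ht]
  · rw [realConv_indicator (causal_fracKernel one_pos) hD ht.le]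
    simp [fracKernel_one, (hz t ht).integral_deriv_eq_sub, ht, sub_eq_add_neg]

theorem indicator_ae_eq_realConv_of_caputoDeriv (hδ1 : δ < 1)
    (hz : ∀ T > 0, AbsolutelyContinuousOnInterval z 0 T)
    (heq : ∀ᵐ t : ℝ, 0 < t → caputoDeriv δ z t = -a * z t + G t) :
    (Ioi 0).indicator G + (-a) • (Ioi 0).indicator z =ᵐ[volume]
      realConv ((Ioi 0).indicator (fracKernel (1 - δ))) ((Ioi 0).indicator (deriv z)) := by
  have hD := causal_indicator fun T hT => (hz T hT).intervalIntegrable_deriv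
  filter_upwards [heq] with t h
  rcases le_or_gt t 0 with ht | ht
  · rw [((causal_fracKernel (sub_pos.2 hδ1)).conv hD).zero t ht]
    simp [ht]
  · rw [← caputoDeriv_eq_realConv hδ1 hD ht, h ht]
    simp [ht, add_comm]

theorem causal_indicator_of_caputoDeriv (hδ1 : δ < 1)
    (hz : ∀ T > 0, AbsolutelyContinuousOnInterval z 0 T)
    (heq : ∀ᵐ t : ℝ, 0 < t → caputoDeriv δ z t = -a * z t + G t) :
    Causal ((Ioi 0).indicator G) := by
  have hD := causal_indicator fun T hT => (hz T hT).intervalIntegrable_deriv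
  have hZ := causal_indicator fun T hT => (hz T hT).continuousOn.intervalIntegrable
  refine (((causal_fracKernel (sub_pos.2 hδ1)).conv hD).add (hZ.const_smul a)).congr ?_
    fun t ht => indicator_of_notMem (notMem_Ioi.2 ht) _
  filter_upwards [indicator_ae_eq_realConv_of_caputoDeriv hδ1 hz heq] with t ht
  simp only [Pi.add_apply, Pi.smul_apply, smul_eq_mul] at ht ⊢
  linarith

theorem caputo_volterra (hδ : 0 < δ) (hδ1 : δ < 1)
    (hz : ∀ T > 0, AbsolutelyContinuousOnInterval z 0 T)
    (heq : ∀ᵐ t : ℝ, 0 < t → caputoDeriv δ z t = -a * z t + G t) :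
    (Ioi 0).indicator z =ᵐ[volume] z 0 • (Ioi 0).indicator (fracKernel 1)
      + realConv ((Ioi 0).indicator (fracKernel δ))
        ((Ioi 0).indicator G + (-a) • (Ioi 0).indicator z) := by
  have hD := causal_indicator fun T hT => (hz T hT).intervalIntegrable_deriv
  rw [realConv_congr_right _ (indicator_ae_eq_realConv_of_caputoDeriv hδ1 hz heq)]
  filter_upwards [(causal_fracKernel hδ).realConv_assoc (causal_fracKernel (sub_pos.2 hδ1)) hD]
    with t ht
  rw [Pi.add_apply, ← ht, realConv_fracKernel_fracKernel (sub_pos.2 hδ1) hδ, sub_add_cancel,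
    realConv_fracKernel_one_deriv hz]
  simp

theorem caputo_variation_of_constants (hδ : 0 < δ) (hδ1 : δ < 1)
    (hz : ∀ T > 0, AbsolutelyContinuousOnInterval z 0 T)
    (heq : ∀ᵐ t : ℝ, 0 < t → caputoDeriv δ z t = -a * z t + G t) :
    ∀ᵐ t : ℝ, 0 < t → z t = z 0 * mlKernel δ a 1 t
      + ∫ s in (0 : ℝ)..t, mlKernel δ a δ (t - s) * G s := by
  have hG := causal_indicator_of_caputoDeriv hδ1 hz heq
  have hZ := causal_indicator fun T hT => (hz T hT).continuousOn.intervalIntegrable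
  have hr := causal_mlKernel (ξ := a) hδ hδ
  have hone := indicator_mlKernel_eq_add_realConv (ξ := a) hδ one_pos
  have hz' := causal_resolvent_of_volterra (causal_fracKernel hδ) hr hZ
    ((causal_fracKernel one_pos).const_smul (z 0)) hG
    (indicator_mlKernel_eq_add_realConv hδ hδ).eventuallyEq (caputo_volterra hδ hδ1 hz heq)
  filter_upwards [hz'] with t ht ht0
  have honet := congrFun hone t
  rw [realConv_comm] at honet
  simp only [realConv_smul, Pi.add_apply, Pi.smul_apply, smul_eq_mul,
    realConv_indicator hr hG ht0.le, indicator_of_mem (mem_Ioi.2 ht0)] at ht honet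
  linear_combination ht - z 0 * honet

end Caputo

section CaputoBound

variable {δ ξ a T : ℝ} {z G f : ℝ → ℝ}

theorem mlKernel_nonneg (hδ : 0 < δ) (hδ1 : δ ≤ 1) (hξ : 0 ≤ ξ) {t : ℝ} (ht : 0 ≤ t) :
    0 ≤ mlKernel δ ξ δ t := by
  rcases ht.eq_or_lt with rfl | ht
  · rw [mlKernel, Real.zero_rpow hδ.ne', mul_zero, mittagLeffler₂_zero]
    have := Real.Gamma_pos_of_pos hδ
    positivity
  · exact (mlKernel_pos hδ hδ1 hξ ht).le

theorem intervalIntegrable_mlKernel_mul (hδ : 0 < δ) (hf : Continuous f) (t : ℝ) :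
    IntervalIntegrable (fun s => mlKernel δ ξ δ (t - s) * f s) volume 0 t := by
  have hkernel := (intervalIntegrable_mlKernel (ξ := ξ) hδ hδ 0 t).comp_sub_left t
  rw [sub_zero, sub_self] at hkernel
  exact hkernel.symm.mul_continuousOn hf.continuousOn

theorem abs_integral_mlKernel_mul_le (hδ : 0 < δ) (hδ1 : δ ≤ 1) (hξ : 0 ≤ ξ) (ha : ξ ≤ a)
    (hf : Continuous f) {t : ℝ} (ht : 0 ≤ t) (hG : ∀ s ∈ Ioc 0 t, |G s| ≤ f s) :
    |∫ s in (0 : ℝ)..t, mlKernel δ a δ (t - s) * G s|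
      ≤ ∫ s in (0 : ℝ)..t, mlKernel δ ξ δ (t - s) * f s := by
  rw [← Real.norm_eq_abs]
  refine intervalIntegral.norm_integral_le_of_norm_le ht (Eventually.of_forall fun s hs => ?_)
    (intervalIntegrable_mlKernel_mul hδ hf t)
  have hts : 0 ≤ t - s := sub_nonneg.2 hs.2
  rw [norm_mul, Real.norm_of_nonneg (mlKernel_nonneg hδ hδ1 (hξ.trans ha) hts)]
  exact mul_le_mul (mlKernel_le_of_le hδ hδ1 hξ ha hts) (hG s hs) (abs_nonneg _)
    (mlKernel_nonneg hδ hδ1 hξ hts)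

theorem abs_le_of_caputo {C : ℝ} (hδ : 0 < δ) (hδ1 : δ < 1) (hξ : 0 ≤ ξ) (ha : ξ ≤ a)
    (hT : 0 < T) (hz : ∀ T > 0, AbsolutelyContinuousOnInterval z 0 T)
    (heq : ∀ᵐ t : ℝ, 0 < t → caputoDeriv δ z t = -a * z t + G t)
    (hf : Continuous f) (hG : ∀ s ∈ Ioo 0 T, |G s| ≤ f s)
    (hcond : ∀ t > 0, ∫ s in (0 : ℝ)..t, mlKernel δ ξ δ (t - s) * f s ≤ C * mlKernel δ ξ 1 t) :
    |z T| ≤ (|z 0| + C) * mlKernel δ ξ 1 T := by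
  have hae : ∀ᵐ t : ℝ, t ∈ Ioo 0 T → |z t| ≤ (|z 0| + C) * mlKernel δ ξ 1 t := by
    filter_upwards [caputo_variation_of_constants hδ hδ1 hz heq] with t hrep ht
    have hhom : |z 0 * mlKernel δ a 1 t| ≤ |z 0| * mlKernel δ ξ 1 t := by
      rw [abs_mul, abs_of_pos (mlKernel_one_pos hδ hδ1 (hξ.trans ha) ht.1.le)]
      exact mul_le_mul_of_nonneg_left (mlKernel_one_le_of_le hδ hδ1 hξ ha ht.1.le) (abs_nonneg _)
    have hforce := (abs_integral_mlKernel_mul_le hδ hδ1.le hξ ha hf ht.1.le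
      fun s hs => hG s ⟨hs.1, hs.2.trans_lt ht.2⟩).trans (hcond t ht.1)
    rw [hrep ht.1, add_mul]
    exact (abs_add_le _ _).trans (add_le_add hhom hforce)
  have hzT : ContinuousOn z (Icc 0 T) := uIcc_of_le hT.le ▸ (hz T hT).continuousOn
  have hE : Continuous fun t => (|z 0| + C) * mlKernel δ ξ 1 t :=
    continuous_const.mul (continuous_mlKernel_one hδ)
  have hall := le_on_open_of_ae_le isOpen_Ioo hae (hzT.mono Ioo_subset_Icc_self).abs
    hE.continuousOn
  rw [← closure_Ioo hT.ne] at hzT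
  exact le_on_closure hall hzT.abs hE.continuousOn
    (closure_Ioo hT.ne ▸ right_mem_Icc.2 hT.le)

end CaputoBound

/-! ### Distributed delays -/

/-- A nonnegative delay kernel of finite integral on `(0, ∞)`; unlike `IsDelayKernel` this asks
for no piecewise continuity. -/
structure IsIntegrableKernel (k : ℝ → ℝ) : Prop where
  nonneg : ∀ w > 0, 0 ≤ k w
  integrableOn : IntegrableOn k (Ioi 0)

theorem IsDelayKernel.isIntegrableKernel {k : ℝ → ℝ} (hk : IsDelayKernel k) :
    IsIntegrableKernel k :=
  ⟨fun w hw => hk.nonneg w (le_of_lt hw), hk.integrableOn⟩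

/-- The distributed delay of `f` with kernel `k`. -/
noncomputable def distributedDelay (k f : ℝ → ℝ) (t : ℝ) : ℝ :=
  ∫ w in Ioi (0 : ℝ), k w * f (t - w)

section Delay

variable {k h K D f₁ f₂ : ℝ → ℝ} {m₁ m₂ C₁ C₂ t : ℝ}

theorem setIntegral_Iic_eq_distributedDelay (k f : ℝ → ℝ) (t : ℝ) :
    ∫ l in Iic t, f l * k (t - l) = distributedDelay k f t := by
  have hcomp := integral_sub_left_eq_self
    ((Iic t).indicator fun l => f l * k (t - l)) volume t
  rw [integral_indicator measurableSet_Iic] at hcomp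
  rw [← hcomp, distributedDelay, ← integral_Ici_eq_integral_Ioi,
    ← integral_indicator measurableSet_Ici]
  congr 1
  funext w
  by_cases hw : 0 ≤ w <;> simp [hw, mul_comm]

theorem integrableOn_mul_comp_sub (hk : IntegrableOn k (Ioi 0)) (hD : Continuous D)
    (hD01 : ∀ s, D s ∈ Icc 0 1) (t : ℝ) : IntegrableOn (fun w => k w * D (t - w)) (Ioi 0) :=
  Integrable.mul_bdd (c := 1) hk
    (hD.comp (continuous_const.sub continuous_id)).aestronglyMeasurable
    (Eventually.of_forall fun w => by
      rw [Real.norm_of_nonneg (hD01 _).1]; exact (hD01 _).2)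

theorem continuous_distributedDelay (hk : IntegrableOn k (Ioi 0)) (hD : Continuous D)
    (hD01 : ∀ s, D s ∈ Icc 0 1) : Continuous (distributedDelay k D) := by
  refine continuous_of_dominated (bound := fun w => ‖k w‖)
    (fun t => (integrableOn_mul_comp_sub hk hD hD01 t).aestronglyMeasurable)
    (fun t => Eventually.of_forall fun w => ?_) hk.norm
    (Eventually.of_forall fun w => continuous_const.mul
      (hD.comp (continuous_id.sub continuous_const)))
  rw [norm_mul, Real.norm_of_nonneg (hD01 _).1]
  exact mul_le_of_le_one_right (norm_nonneg _) (hD01 _).2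

theorem distributedDelay_mono_left (hk : IntegrableOn k (Ioi 0)) (hK : IntegrableOn K (Ioi 0))
    (hkK : ∀ w > 0, k w ≤ K w) (hD : Continuous D) (hD01 : ∀ s, D s ∈ Icc 0 1) (t : ℝ) :
    distributedDelay k D t ≤ distributedDelay K D t :=
  setIntegral_mono_on (integrableOn_mul_comp_sub hk hD hD01 t)
    (integrableOn_mul_comp_sub hK hD hD01 t) measurableSet_Ioi fun w hw =>
    mul_le_mul_of_nonneg_right (hkK w hw) (hD01 _).1

theorem kernelMass_nonneg (hk : IsIntegrableKernel k) : 0 ≤ kernelMass k :=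
  setIntegral_nonneg measurableSet_Ioi hk.nonneg

theorem distributedDelay_le_kernelMass (hk : IsIntegrableKernel k) (hD : Continuous D)
    (hD01 : ∀ s, D s ∈ Icc 0 1) (t : ℝ) : distributedDelay k D t ≤ kernelMass k :=
  setIntegral_mono_on (integrableOn_mul_comp_sub hk.integrableOn hD hD01 t) hk.integrableOn
    measurableSet_Ioi fun w hw => mul_le_of_le_one_right (hk.nonneg w hw) (hD01 _).2

theorem abs_distributedDelay_sub_le (hk : IsIntegrableKernel k) (hD : Continuous D)
    (hD01 : ∀ s, D s ∈ Icc 0 1) (hint : IntegrableOn (fun w => k w * f₁ (t - w)) (Ioi 0))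
    (hf : ∀ s < t, |f₁ s - m₁| ≤ C₁ * D s) :
    |distributedDelay k f₁ t - kernelMass k * m₁| ≤ C₁ * distributedDelay k D t := by
  rw [distributedDelay, distributedDelay, kernelMass, ← integral_mul_const,
    ← integral_sub hint (hk.integrableOn.mul_const _), ← integral_const_mul, ← Real.norm_eq_abs]
  refine norm_integral_le_of_norm_le
    ((integrableOn_mul_comp_sub hk.integrableOn hD hD01 t).const_mul _) ?_
  filter_upwards [ae_restrict_mem measurableSet_Ioi] with w hw
  rw [← mul_sub, norm_mul, Real.norm_of_nonneg (hk.nonneg w hw), Real.norm_eq_abs,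
    mul_left_comm C₁]
  exact mul_le_mul_of_nonneg_left (hf _ (sub_lt_self t hw)) (hk.nonneg w hw)

theorem abs_mul_sub_mul_le {P Q p q α β α' : ℝ} (hP : |P - p| ≤ α) (hQ : |Q - q| ≤ β)
    (hQ' : |Q - q| ≤ α') :
    |P * Q - p * q| ≤ α * |q| + |p| * β + α * α' := by
  have hα : 0 ≤ α := (abs_nonneg _).trans hP
  calc |P * Q - p * q| = |(P - p) * q + p * (Q - q) + (P - p) * (Q - q)| := by ring_nf
    _ ≤ |P - p| * |q| + |p| * |Q - q| + |P - p| * |Q - q| := by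
        simpa only [abs_mul] using abs_add_three ((P - p) * q) (p * (Q - q)) ((P - p) * (Q - q))
    _ ≤ α * |q| + |p| * β + α * α' := by gcongr

theorem abs_distributedDelay_mul_sub_le (hk : IsIntegrableKernel k) (hh : IsIntegrableKernel h)
    (hK : IntegrableOn K (Ioi 0)) (hkK : ∀ w > 0, k w ≤ K w) (hhK : ∀ w > 0, h w ≤ K w)
    (hD : Continuous D) (hD01 : ∀ s, D s ∈ Icc 0 1) (hC₁ : 0 ≤ C₁) (hC₂ : 0 ≤ C₂)
    (hint₁ : IntegrableOn (fun w => k w * f₁ (t - w)) (Ioi 0))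
    (hint₂ : IntegrableOn (fun w => h w * f₂ (t - w)) (Ioi 0))
    (hf₁ : ∀ s < t, |f₁ s - m₁| ≤ C₁ * D s) (hf₂ : ∀ s < t, |f₂ s - m₂| ≤ C₂ * D s) :
    |distributedDelay k f₁ t * distributedDelay h f₂ t - kernelMass k * m₁ * (kernelMass h * m₂)|
      ≤ (C₁ * kernelMass h * |m₂| + C₂ * kernelMass k * |m₁| + C₁ * C₂ * kernelMass h)
        * distributedDelay K D t := by
  have hP : |distributedDelay k f₁ t - kernelMass k * m₁| ≤ C₁ * distributedDelay K D t :=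
    (abs_distributedDelay_sub_le hk hD hD01 hint₁ hf₁).trans (mul_le_mul_of_nonneg_left
      (distributedDelay_mono_left hk.integrableOn hK hkK hD hD01 t) hC₁)
  have hQ := abs_distributedDelay_sub_le hh hD hD01 hint₂ hf₂
  refine (abs_mul_sub_mul_le hP (hQ.trans (mul_le_mul_of_nonneg_left
    (distributedDelay_mono_left hh.integrableOn hK hhK hD hD01 t) hC₂))
    (hQ.trans (mul_le_mul_of_nonneg_left
      (distributedDelay_le_kernelMass hh hD hD01 t) hC₂))).trans_eq ?_
  rw [abs_mul, abs_mul, abs_of_nonneg (kernelMass_nonneg hk),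
    abs_of_nonneg (kernelMass_nonneg hh)]
  ring

end Delay

theorem integrableOn_ciSup_of_finite {ι α : Type*} [Finite ι] [Nonempty ι] [MeasurableSpace α]
    {μ : Measure α} {S : Set α} {f : ι → α → ℝ} (hf : ∀ i, IntegrableOn (f i) S μ) :
    IntegrableOn (fun t => ⨆ i, f i t) S μ := by
  have := Fintype.ofFinite ι
  refine Integrable.mono' (integrable_finsetSum Finset.univ fun i _ => (hf i).norm)
    (AEMeasurable.iSup fun i => (hf i).aemeasurable).aestronglyMeasurable
    (Eventually.of_forall fun t => ?_)
  obtain ⟨i, hi⟩ := exists_eq_ciSup_of_finite (f := fun i => f i t)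
  rw [← hi]
  exact Finset.single_le_sum (f := fun i => ‖f i t‖) (fun _ _ => norm_nonneg _) (Finset.mem_univ i)

/-! ### Exchanging the two layers -/

namespace BAMNetwork

variable {n₁ n₂ : ℕ} {N : BAMNetwork n₁ n₂} {L : Fin n₂ → ℝ} {M : Fin n₁ → ℝ}
  {xs : Fin n₁ → ℝ} {ys : Fin n₂ → ℝ} {Ω : ℝ}

variable (N) in
/-- The network with its two layers exchanged; it reduces every estimate on the `y`-layer to the
one on the `x`-layer. -/
def swap : BAMNetwork n₂ n₁ where
  δ := N.δ
  μ := N.μ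
  c := N.cbar
  cbar := N.c
  a := N.abar
  abar := N.a
  d := N.dbar
  dbar := N.d
  k := N.kbar
  h := N.hbar
  kbar := N.k
  hbar := N.h
  g := N.gbar
  gbar := N.g
  I := N.J
  J := N.I
  δ_pos := N.δ_pos
  δ_lt_one := N.δ_lt_one
  μ_pos := N.μ_pos
  c_pos := N.cbar_pos
  cbar_pos := N.c_pos
  a_pos := N.abar_pos
  abar_pos := N.a_pos

variable (N) in
/-- (A1) without piecewise continuity. -/
structure IntegrableKernels : Prop where
  kernel_k : ∀ q p s, IsIntegrableKernel (N.k q p s)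
  kernel_h : ∀ q p s, IsIntegrableKernel (N.h q p s)
  kernel_kbar : ∀ p q r, IsIntegrableKernel (N.kbar p q r)
  kernel_hbar : ∀ p q r, IsIntegrableKernel (N.hbar p q r)

theorem KernelAssumption.integrableKernels (hker : N.KernelAssumption) : N.IntegrableKernels where
  kernel_k q p s := (hker.kernel_k q p s).isIntegrableKernel
  kernel_h q p s := (hker.kernel_h q p s).isIntegrableKernel
  kernel_kbar p q r := (hker.kernel_kbar p q r).isIntegrableKernel
  kernel_hbar p q r := (hker.kernel_hbar p q r).isIntegrableKernel

theorem IntegrableKernels.swap (hker : N.IntegrableKernels) : N.swap.IntegrableKernels :=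
  ⟨hker.kernel_kbar, hker.kernel_hbar, hker.kernel_k, hker.kernel_h⟩

theorem IsSolution.swap {φ : Fin n₁ → ℝ → ℝ} {ψ : Fin n₂ → ℝ → ℝ} {x : Fin n₁ → ℝ → ℝ}
    {y : Fin n₂ → ℝ → ℝ} (hsol : N.IsSolution φ ψ x y) : N.swap.IsSolution ψ φ y x where
  continuous_x := hsol.continuous_y
  continuous_y := hsol.continuous_x
  history_x := hsol.history_y
  history_y := hsol.history_x
  integrable_k := hsol.integrable_kbar
  integrable_h := hsol.integrable_hbar
  integrable_kbar := hsol.integrable_k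
  integrable_hbar := hsol.integrable_h
  absCont_x := hsol.absCont_y
  absCont_y := hsol.absCont_x
  eq_x := hsol.eq_y
  eq_y := hsol.eq_x

theorem IsEquilibrium.swap (hEq : N.IsEquilibrium xs ys) : N.swap.IsEquilibrium ys xs :=
  ⟨hEq.eq_y, hEq.eq_x⟩

theorem LipschitzActivations.swap (hlip : N.LipschitzActivations L M) :
    N.swap.LipschitzActivations M L :=
  ⟨hlip.lip_gbar, hlip.lip_g⟩

variable (N)

theorem ξ_swap : N.swap.ξ = N.ξ := min_comm _ _

theorem cStar_swap : N.swap.cStar = N.cStar := max_comm _ _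

theorem bigU_swap : N.swap.bigU = N.bigU := by
  rw [bigU, bigU, ξ_swap, bigA, bigA, max_comm]
  rfl

theorem bStar_swap : N.swap.bStar = N.bStar := by
  rw [bStar, bStar, bigB, bigB, bigF, bigF, ξ_swap]
  rfl

theorem kStar_swap : N.swap.kStar = N.kStar := funext fun _ => max_comm _ _

theorem theta_swap (M : Fin n₁ → ℝ) (xs : Fin n₁ → ℝ) :
    N.swap.theta M xs = N.thetaBar M xs :=
  Finset.sum_comm.trans (Finset.sum_congr rfl fun _ _ => Finset.sum_comm)

theorem piConst_swap (L : Fin n₂ → ℝ) (M : Fin n₁ → ℝ) (xs : Fin n₁ → ℝ) (ys : Fin n₂ → ℝ) :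
    N.swap.piConst M L ys xs = N.piConst L M xs ys := by
  rw [piConst, piConst, theta_swap, max_comm, ← theta_swap N.swap]
  rfl

variable {N}

theorem SmallnessAssumption.swap (hsmall : N.SmallnessAssumption L M xs ys Ω) :
    N.swap.SmallnessAssumption M L ys xs Ω where
  Ω_pos := hsmall.Ω_pos
  Ω_small := by rw [piConst_swap]; exact hsmall.Ω_small
  c_small := by rw [cStar_swap, bStar_swap, bigU_swap]; exact hsmall.c_small
  kernel_condition := by rw [ξ_swap, kStar_swap]; exact hsmall.kernel_condition

/-! ### Constants of the network -/

theorem LipschitzActivations.nonneg (hlip : N.LipschitzActivations L M) (q : Fin n₂) :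
    0 ≤ L q := by
  simpa using (abs_nonneg _).trans (hlip.lip_g q 1 0)

theorem aMin_pos [NeZero n₁] : 0 < N.aMin := by
  obtain ⟨p, hp⟩ := exists_eq_ciInf_of_finite (f := N.a)
  exact (N.a_pos p).trans_eq hp

theorem ξ_pos [NeZero n₁] [NeZero n₂] : 0 < N.ξ :=
  lt_min aMin_pos (aMin_pos (N := N.swap))

theorem ξ_le_a (p : Fin n₁) : N.ξ ≤ N.a p :=
  (min_le_left _ _).trans (ciInf_le (finite_range _).bddBelow p)

theorem bStar_pos (hξ : 0 < N.ξ) : 0 < N.bStar := by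
  have := Real.Gamma_pos_of_pos (sub_pos.2 N.δ_lt_one)
  have := N.μ_pos
  exact lt_of_lt_of_le (by rw [bigB]; positivity) (le_max_left _ _)

theorem IntegrableKernels.integrableOn_kernelK [NeZero n₁] [NeZero n₂]
    (hker : N.IntegrableKernels) : IntegrableOn N.kernelK (Ioi 0) :=
  Integrable.sup
    (integrableOn_ciSup_of_finite fun _ => (hker.kernel_k _ _ _).integrableOn)
    (integrableOn_ciSup_of_finite fun _ => (hker.kernel_h _ _ _).integrableOn)

theorem IntegrableKernels.integrableOn_kStar [NeZero n₁] [NeZero n₂]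
    (hker : N.IntegrableKernels) : IntegrableOn N.kStar (Ioi 0) :=
  Integrable.sup hker.integrableOn_kernelK hker.swap.integrableOn_kernelK

theorem k_le_kStar (q : Fin n₂) (p : Fin n₁) (s : Fin n₂) (w : ℝ) : N.k q p s w ≤ N.kStar w :=
  (le_ciSup (f := fun i : Fin n₂ × Fin n₁ × Fin n₂ => N.k i.1 i.2.1 i.2.2 w)
    (finite_range _).bddAbove (q, p, s)).trans ((le_max_left _ _).trans (le_max_left _ _))

theorem h_le_kStar (q : Fin n₂) (p : Fin n₁) (s : Fin n₂) (w : ℝ) : N.h q p s w ≤ N.kStar w :=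
  (le_ciSup (f := fun i : Fin n₂ × Fin n₁ × Fin n₂ => N.h i.1 i.2.1 i.2.2 w)
    (finite_range _).bddAbove (q, p, s)).trans ((le_max_right _ _).trans (le_max_left _ _))

theorem SmallnessAssumption.integral_mlKernel_mul_distributedDelay_le
    (hsmall : N.SmallnessAssumption L M xs ys Ω) {t : ℝ} (ht : 0 < t) :
    ∫ s in (0 : ℝ)..t, mlKernel N.δ N.ξ N.δ (t - s) *
      distributedDelay N.kStar (mlDecay N.δ N.ξ) s ≤ Ω * mlKernel N.δ N.ξ 1 t := by
  have hcond := hsmall.kernel_condition t ht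
  simp only [setIntegral_Iic_eq_distributedDelay] at hcond
  rw [mlKernel_one]
  exact hcond

theorem SmallnessAssumption.c_lt_one (hsmall : N.SmallnessAssumption L M xs ys Ω) : N.c < 1 :=
  (le_max_left _ _).trans_lt (hsmall.c_small.trans_le (min_le_left _ _))

theorem SmallnessAssumption.c_mul_bStar_lt [NeZero n₁] [NeZero n₂]
    (hsmall : N.SmallnessAssumption L M xs ys Ω) :
    N.c * N.bStar * (1 + (∑ p, N.a p) * (Real.Gamma (1 + N.δ) * Real.Gamma (1 - N.δ) / N.ξ))
      < 1 / 2 := by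
  have hB := bStar_pos N.ξ_pos
  have hc := N.c_pos
  have hratio : 0 ≤ Real.Gamma (1 + N.δ) * Real.Gamma (1 - N.δ) / N.ξ :=
    div_nonneg (mul_nonneg (Real.Gamma_nonneg_of_nonneg (by linarith [N.δ_pos]))
      (Real.Gamma_nonneg_of_nonneg (sub_nonneg.2 N.δ_lt_one.le))) N.ξ_pos.le
  have hU : 0 ≤ N.bigU := mul_nonneg
    ((Finset.sum_nonneg fun p _ => (N.a_pos p).le).trans (le_max_left _ _)) hratio
  have hcU : N.c * (2 * N.bStar * (1 + N.bigU)) < 1 := (lt_div_iff₀ (by positivity)).1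
    ((le_max_left _ _).trans_lt (hsmall.c_small.trans_le (min_le_right _ _)))
  calc _ ≤ N.c * N.bStar * (1 + N.bigU) := by
        rw [bigU]
        gcongr
        exact le_max_left _ _
    _ < 1 / 2 := by linarith

theorem SmallnessAssumption.mul_theta_lt (hsmall : N.SmallnessAssumption L M xs ys Ω) :
    Ω * N.theta L ys < 1 / 4 :=
  (mul_le_mul_of_nonneg_left (le_max_left _ _) hsmall.Ω_pos.le).trans_lt hsmall.Ω_small

end BAMNetwork

/-! ### Deviation from the equilibrium -/

/-- The `ℓ¹` distance `u(t)` of a layer `x` from its equilibrium value `xs`. -/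
def layerDev {ι : Type*} [Fintype ι] (x : ι → ℝ → ℝ) (xs : ι → ℝ) (t : ℝ) : ℝ :=
  ∑ i, |x i t - xs i|

section LayerDev

variable {ι : Type*} [Fintype ι] {x : ι → ℝ → ℝ} {xs : ι → ℝ}

theorem abs_sub_le_layerDev (i : ι) (t : ℝ) : |x i t - xs i| ≤ layerDev x xs t :=
  Finset.single_le_sum (f := fun i => |x i t - xs i|) (fun _ _ => abs_nonneg _)
    (Finset.mem_univ i)

theorem layerDev_nonneg (t : ℝ) : 0 ≤ layerDev x xs t :=
  Finset.sum_nonneg fun _ _ => abs_nonneg _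

theorem continuous_layerDev (hx : ∀ i, Continuous (x i)) : Continuous (layerDev x xs) :=
  continuous_finsetSum _ fun i _ => ((hx i).sub continuous_const).abs

end LayerDev

namespace BAMNetwork

variable {n₁ n₂ : ℕ} {N : BAMNetwork n₁ n₂} {L : Fin n₂ → ℝ} {M : Fin n₁ → ℝ}
  {xs : Fin n₁ → ℝ} {ys : Fin n₂ → ℝ} {φ : Fin n₁ → ℝ → ℝ} {ψ : Fin n₂ → ℝ → ℝ}
  {x : Fin n₁ → ℝ → ℝ} {y : Fin n₂ → ℝ → ℝ} {Ω R V T : ℝ} {p : Fin n₁}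

variable (N) in
/-- The summand of `theta` belonging to the neuron `p`. -/
noncomputable def neuronTheta (L ys : Fin n₂ → ℝ) (p : Fin n₁) : ℝ :=
  ∑ q, ∑ s, |N.d q p s| *
    (L q * kernelMass (N.h q p s) * |N.g s (ys s)|
      + L s * kernelMass (N.k q p s) * |N.g q (ys q)|)

variable (N) in
/-- The coefficient of the quadratic remainder when the interaction terms of the neuron `p` are
expanded at the equilibrium. -/
noncomputable def neuronQuad (L : Fin n₂ → ℝ) (p : Fin n₁) : ℝ :=
  ∑ q, ∑ s, |N.d q p s| * (L q * L s * kernelMass (N.h q p s))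

variable (N) in
/-- The coefficient of the quadratic remainder of the whole `x`-layer. -/
noncomputable def quadConst (L : Fin n₂ → ℝ) : ℝ :=
  ∑ p, N.neuronQuad L p

theorem neuronTheta_nonneg (hker : N.IntegrableKernels) (hL : ∀ q, 0 ≤ L q) :
    0 ≤ N.neuronTheta L ys p :=
  Finset.sum_nonneg fun q _ => Finset.sum_nonneg fun s _ => mul_nonneg (abs_nonneg _) <|
    add_nonneg
      (mul_nonneg (mul_nonneg (hL q) (kernelMass_nonneg (hker.kernel_h q p s))) (abs_nonneg _))
      (mul_nonneg (mul_nonneg (hL s) (kernelMass_nonneg (hker.kernel_k q p s))) (abs_nonneg _))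

theorem neuronQuad_nonneg (hker : N.IntegrableKernels) (hL : ∀ q, 0 ≤ L q) :
    0 ≤ N.neuronQuad L p :=
  Finset.sum_nonneg fun q _ => Finset.sum_nonneg fun s _ => mul_nonneg (abs_nonneg _) <|
    mul_nonneg (mul_nonneg (hL q) (hL s)) (kernelMass_nonneg (hker.kernel_h q p s))

theorem quadConst_nonneg (hker : N.IntegrableKernels) (hL : ∀ q, 0 ≤ L q) :
    0 ≤ N.quadConst L :=
  Finset.sum_nonneg fun _ _ => neuronQuad_nonneg hker hL

theorem rhsX_add_eq (hEq : N.IsEquilibrium xs ys) (x : Fin n₁ → ℝ → ℝ) (y : Fin n₂ → ℝ → ℝ)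
    (p : Fin n₁) (t : ℝ) :
    N.rhsX x y p t + N.a p * (x p t - xs p) = ∑ q, ∑ s, N.d q p s *
      (distributedDelay (N.k q p s) (fun t => N.g q (y q t)) t
          * distributedDelay (N.h q p s) (fun t => N.g s (y s t)) t
        - kernelMass (N.k q p s) * N.g q (ys q) * (kernelMass (N.h q p s) * N.g s (ys s))) := by
  have hbalance := hEq.eq_x p
  simp only [mul_sub, Finset.sum_sub_distrib, rhsX, distributedDelay]
  simp only [← mul_assoc]
  linarith

theorem abs_rhsX_add_le {K D : ℝ → ℝ} (hEq : N.IsEquilibrium xs ys) (hker : N.IntegrableKernels)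
    (hlip : N.LipschitzActivations L M) (hsol : N.IsSolution φ ψ x y)
    (hK : IntegrableOn K (Ioi 0)) (hkK : ∀ q p s, ∀ w > 0, N.k q p s w ≤ K w)
    (hhK : ∀ q p s, ∀ w > 0, N.h q p s w ≤ K w) (hD : Continuous D)
    (hD01 : ∀ s, D s ∈ Icc 0 1) (hR : 0 ≤ R) {t : ℝ} (ht : 0 < t)
    (hy : ∀ s < t, layerDev y ys s ≤ R * D s) :
    |N.rhsX x y p t + N.a p * (x p t - xs p)|
      ≤ (N.neuronTheta L ys p + N.neuronQuad L p * R) * R * distributedDelay K D t := by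
  have hg : ∀ q, ∀ s < t, |N.g q (y q s) - N.g q (ys q)| ≤ L q * R * D s := fun q s hs => by
    rw [mul_assoc]
    exact (hlip.lip_g q _ _).trans (mul_le_mul_of_nonneg_left
      ((abs_sub_le_layerDev q s).trans (hy s hs)) (hlip.nonneg q))
  rw [rhsX_add_eq hEq, neuronTheta, neuronQuad]
  simp only [Finset.sum_mul, ← Finset.sum_add_distrib]
  refine (Finset.abs_sum_le_sum_abs _ _).trans (Finset.sum_le_sum fun q _ => ?_)
  refine (Finset.abs_sum_le_sum_abs _ _).trans (Finset.sum_le_sum fun s _ => ?_)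
  have hexpand := mul_le_mul_of_nonneg_left (abs_distributedDelay_mul_sub_le
    (hker.kernel_k q p s) (hker.kernel_h q p s) hK (hkK q p s) (hhK q p s) hD hD01
    (mul_nonneg (hlip.nonneg q) hR) (mul_nonneg (hlip.nonneg s) hR)
    (hsol.integrable_k q p s t ht) (hsol.integrable_h q p s t ht) (hg q) (hg s))
    (abs_nonneg (N.d q p s))
  rw [abs_mul]
  exact hexpand.trans_eq (by ring)

/-! ### The neutral combination -/

variable (N) in
/-- The deviation of the neutral combination `x_p(t) - c x_p(t - μ)` from its equilibrium value;
this is the quantity whose Caputo derivative the network prescribes. -/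
def neutralDev (x : Fin n₁ → ℝ → ℝ) (xs : Fin n₁ → ℝ) (p : Fin n₁) (t : ℝ) : ℝ :=
  (x p t - xs p) - N.c * (x p (t - N.μ) - xs p)

theorem neutralDev_eq (x : Fin n₁ → ℝ → ℝ) (xs : Fin n₁ → ℝ) (p : Fin n₁) :
    N.neutralDev x xs p = fun t => x p t - N.c * x p (t - N.μ) - (1 - N.c) * xs p := by
  funext t
  rw [neutralDev]
  ring

theorem IsSolution.absolutelyContinuousOnInterval_neutralDev (hsol : N.IsSolution φ ψ x y)
    (hT : 0 < T) : AbsolutelyContinuousOnInterval (N.neutralDev x xs p) 0 T := by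
  rw [neutralDev_eq]
  exact (hsol.absCont_x p T hT).sub
    (LipschitzWith.const ((1 - N.c) * xs p)).lipschitzOnWith.absolutelyContinuousOnInterval

theorem IsSolution.caputoDeriv_neutralDev (hsol : N.IsSolution φ ψ x y) :
    ∀ᵐ t : ℝ, 0 < t → caputoDeriv N.δ (N.neutralDev x xs p) t
      = -N.a p * N.neutralDev x xs p t + (N.rhsX x y p t + N.a p * N.neutralDev x xs p t) := by
  filter_upwards [hsol.eq_x p] with t heq ht
  have hderiv : caputoDeriv N.δ (N.neutralDev x xs p) t
      = caputoDeriv N.δ (fun t => x p t - N.c * x p (t - N.μ)) t := by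
    simp only [caputoDeriv, neutralDev_eq, deriv_sub_const_fun]
  rw [hderiv, heq ht]
  ring

theorem abs_neutralDev_le (x : Fin n₁ → ℝ → ℝ) (xs : Fin n₁ → ℝ) (p : Fin n₁) (t : ℝ) :
    |N.neutralDev x xs p t| ≤ |x p t - xs p| + N.c * |x p (t - N.μ) - xs p| := by
  rw [neutralDev]
  exact (abs_sub _ _).trans_eq (by rw [abs_mul, abs_of_pos N.c_pos])

theorem abs_sub_le_abs_neutralDev (x : Fin n₁ → ℝ → ℝ) (xs : Fin n₁ → ℝ) (p : Fin n₁) (t : ℝ) :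
    |x p t - xs p| ≤ |N.neutralDev x xs p t| + N.c * |x p (t - N.μ) - xs p| := by
  have hsplit : x p t - xs p = N.neutralDev x xs p t + N.c * (x p (t - N.μ) - xs p) :=
    (sub_add_cancel _ _).symm
  calc |x p t - xs p| = |N.neutralDev x xs p t + N.c * (x p (t - N.μ) - xs p)| := by rw [← hsplit]
    _ ≤ _ := (abs_add_le _ _).trans_eq (by rw [abs_mul, abs_of_pos N.c_pos])

variable [NeZero n₁] [NeZero n₂]

theorem mlDecay_mem_Icc (s : ℝ) : mlDecay N.δ N.ξ s ∈ Icc 0 1 :=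
  ⟨(mlDecay_pos N.δ_pos N.δ_lt_one N.ξ_pos.le s).le,
    mlDecay_le_one N.δ_pos N.δ_lt_one.le N.ξ_pos.le s⟩

theorem layerDev_sub_le (hR : 0 ≤ R) (hx : ∀ s < T, layerDev x xs s ≤ R * mlDecay N.δ N.ξ s)
    {s : ℝ} (hs : 0 ≤ s) (hsT : s ≤ T) :
    layerDev x xs (s - N.μ) ≤ N.bStar * R * mlDecay N.δ N.ξ s := by
  have hdelay : mlDecay N.δ N.ξ (s - N.μ) ≤ N.bStar * mlDecay N.δ N.ξ s :=
    mlDecay_sub_le N.δ_pos N.δ_lt_one N.ξ_pos N.μ_pos hs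
  calc layerDev x xs (s - N.μ) ≤ R * mlDecay N.δ N.ξ (s - N.μ) :=
        hx _ ((sub_lt_self s N.μ_pos).trans_le hsT)
    _ ≤ R * (N.bStar * mlDecay N.δ N.ξ s) := mul_le_mul_of_nonneg_left hdelay hR
    _ = N.bStar * R * mlDecay N.δ N.ξ s := by ring

theorem abs_rhsX_add_neutralDev_le (hEq : N.IsEquilibrium xs ys) (hker : N.IntegrableKernels)
    (hlip : N.LipschitzActivations L M) (hsol : N.IsSolution φ ψ x y) (hR : 0 ≤ R)
    (hx : ∀ s < T, layerDev x xs s ≤ R * mlDecay N.δ N.ξ s)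
    (hy : ∀ s < T, layerDev y ys s ≤ R * mlDecay N.δ N.ξ s) {t : ℝ} (ht : t ∈ Ioo 0 T) :
    |N.rhsX x y p t + N.a p * N.neutralDev x xs p t|
      ≤ N.a p * N.c * N.bStar * R * mlKernel N.δ N.ξ 1 t
        + (N.neuronTheta L ys p + N.neuronQuad L p * R) * R
          * distributedDelay N.kStar (mlDecay N.δ N.ξ) t := by
  have hac : 0 < N.a p * N.c := mul_pos (N.a_pos p) N.c_pos
  have hinter := abs_rhsX_add_le (p := p) hEq hker hlip hsol hker.integrableOn_kStar
    (fun q p s w _ => k_le_kStar q p s w) (fun q p s w _ => h_le_kStar q p s w)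
    (continuous_mlDecay N.δ_pos) mlDecay_mem_Icc hR ht.1 fun s hs => hy s (hs.trans ht.2)
  have hneutral : |N.a p * N.c * (x p (t - N.μ) - xs p)|
      ≤ N.a p * N.c * N.bStar * R * mlKernel N.δ N.ξ 1 t := by
    have hshift := mul_le_mul_of_nonneg_left ((abs_sub_le_layerDev p (t - N.μ)).trans
      (layerDev_sub_le hR hx ht.1.le ht.2.le)) hac.le
    rw [abs_mul, abs_of_pos hac, ← mlDecay_of_nonneg ht.1.le]
    exact hshift.trans_eq (by ring)
  have hsplit : N.rhsX x y p t + N.a p * N.neutralDev x xs p t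
      = N.rhsX x y p t + N.a p * (x p t - xs p) - N.a p * N.c * (x p (t - N.μ) - xs p) := by
    rw [neutralDev]
    ring
  rw [hsplit, add_comm (_ * mlKernel N.δ N.ξ 1 t)]
  exact (abs_sub _ _).trans (add_le_add hinter hneutral)

theorem SmallnessAssumption.integral_mlKernel_mul_add_le
    (hsmall : N.SmallnessAssumption L M xs ys Ω) (hker : N.IntegrableKernels) {α β : ℝ}
    (hα : 0 ≤ α) (hβ : 0 ≤ β) {t : ℝ} (ht : 0 < t) :
    ∫ s in (0 : ℝ)..t, mlKernel N.δ N.ξ N.δ (t - s) * (α * mlKernel N.δ N.ξ 1 s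
        + β * distributedDelay N.kStar (mlDecay N.δ N.ξ) s)
      ≤ (α * (Real.Gamma (1 + N.δ) * Real.Gamma (1 - N.δ) / N.ξ) + β * Ω)
        * mlKernel N.δ N.ξ 1 t := by
  have hdelay := continuous_distributedDelay hker.integrableOn_kStar
    (continuous_mlDecay N.δ_pos) (mlDecay_mem_Icc (N := N))
  simp only [mul_add, mul_left_comm _ α, mul_left_comm _ β]
  rw [intervalIntegral.integral_add
    ((intervalIntegrable_mlKernel_mul N.δ_pos (continuous_mlKernel_one N.δ_pos) t).const_mul α)
    ((intervalIntegrable_mlKernel_mul N.δ_pos hdelay t).const_mul β),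
    intervalIntegral.integral_const_mul, intervalIntegral.integral_const_mul, add_mul, mul_assoc α,
    mul_assoc β]
  exact add_le_add
    (mul_le_mul_of_nonneg_left
      (integral_mlKernel_mul_mlKernel_one_le N.δ_pos N.δ_lt_one N.ξ_pos ht) hα)
    (mul_le_mul_of_nonneg_left (hsmall.integral_mlKernel_mul_distributedDelay_le ht) hβ)

theorem abs_neutralDev_le_mlDecay (hEq : N.IsEquilibrium xs ys) (hker : N.IntegrableKernels)
    (hlip : N.LipschitzActivations L M) (hsmall : N.SmallnessAssumption L M xs ys Ω)
    (hsol : N.IsSolution φ ψ x y) (hR : 0 ≤ R) (hT : 0 < T)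
    (hx : ∀ s < T, layerDev x xs s ≤ R * mlDecay N.δ N.ξ s)
    (hy : ∀ s < T, layerDev y ys s ≤ R * mlDecay N.δ N.ξ s) (p : Fin n₁) :
    |N.neutralDev x xs p T| ≤ (|N.neutralDev x xs p 0|
        + (N.a p * N.c * N.bStar * R * (Real.Gamma (1 + N.δ) * Real.Gamma (1 - N.δ) / N.ξ)
          + (N.neuronTheta L ys p + N.neuronQuad L p * R) * R * Ω)) * mlDecay N.δ N.ξ T := by
  have hα : 0 ≤ N.a p * N.c * N.bStar * R := by
    have := N.a_pos p
    have := N.c_pos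
    have := bStar_pos N.ξ_pos
    positivity
  have hβ : 0 ≤ (N.neuronTheta L ys p + N.neuronQuad L p * R) * R := by
    have := neuronTheta_nonneg (ys := ys) (p := p) hker hlip.nonneg
    have := neuronQuad_nonneg (p := p) hker hlip.nonneg
    positivity
  rw [mlDecay_of_nonneg hT.le]
  refine abs_le_of_caputo N.δ_pos N.δ_lt_one N.ξ_pos.le (ξ_le_a p) hT
    (fun S hS => hsol.absolutelyContinuousOnInterval_neutralDev hS)
    hsol.caputoDeriv_neutralDev ?_
    (fun s hs => abs_rhsX_add_neutralDev_le hEq hker hlip hsol hR hx hy hs)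
    (fun t ht => hsmall.integral_mlKernel_mul_add_le hker hα hβ ht)
  exact (continuous_const.mul (continuous_mlKernel_one N.δ_pos)).add (continuous_const.mul
    (continuous_distributedDelay hker.integrableOn_kStar (continuous_mlDecay N.δ_pos)
      mlDecay_mem_Icc))

end BAMNetwork

/-! ### Bootstrap -/

namespace BAMNetwork

variable {n₁ n₂ : ℕ} [NeZero n₁] [NeZero n₂] {N : BAMNetwork n₁ n₂} {L : Fin n₂ → ℝ}
  {M : Fin n₁ → ℝ} {xs : Fin n₁ → ℝ} {ys : Fin n₂ → ℝ} {φ : Fin n₁ → ℝ → ℝ}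
  {ψ : Fin n₂ → ℝ → ℝ} {x : Fin n₁ → ℝ → ℝ} {y : Fin n₂ → ℝ → ℝ} {Ω R V T : ℝ}

theorem layerDev_le_coeff_mul_mlDecay (hEq : N.IsEquilibrium xs ys) (hker : N.IntegrableKernels)
    (hlip : N.LipschitzActivations L M) (hsmall : N.SmallnessAssumption L M xs ys Ω)
    (hsol : N.IsSolution φ ψ x y) (hR : 0 ≤ R) (hT : 0 < T)
    (hV : ∀ s ≤ 0, layerDev x xs s ≤ V)
    (hx : ∀ s < T, layerDev x xs s ≤ R * mlDecay N.δ N.ξ s)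
    (hy : ∀ s < T, layerDev y ys s ≤ R * mlDecay N.δ N.ξ s) :
    layerDev x xs T ≤ (2 * V
      + N.c * N.bStar * (1 + (∑ p, N.a p)
          * (Real.Gamma (1 + N.δ) * Real.Gamma (1 - N.δ) / N.ξ)) * R
      + Ω * (N.theta L ys + N.quadConst L * R) * R) * mlDecay N.δ N.ξ T := by
  have hneuron := Finset.sum_le_sum fun p (_ : p ∈ Finset.univ) =>
    (abs_sub_le_abs_neutralDev x xs p T).trans (add_le_add_left
      (abs_neutralDev_le_mlDecay hEq hker hlip hsmall hsol hR hT hx hy p) _)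
  have hinit : ∑ p, |N.neutralDev x xs p 0| ≤ 2 * V :=
    calc ∑ p, |N.neutralDev x xs p 0|
        ≤ ∑ p, (|x p 0 - xs p| + N.c * |x p (0 - N.μ) - xs p|) :=
          Finset.sum_le_sum fun p _ => abs_neutralDev_le x xs p 0
      _ = layerDev x xs 0 + N.c * layerDev x xs (0 - N.μ) := by
          rw [Finset.sum_add_distrib, ← Finset.mul_sum, layerDev, layerDev]
      _ ≤ V + V := add_le_add (hV 0 le_rfl)
          ((mul_le_of_le_one_left (layerDev_nonneg _) hsmall.c_lt_one.le).trans
            (hV _ (by linarith [N.μ_pos])))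
      _ = 2 * V := (two_mul V).symm
  have hneutral := mul_le_mul_of_nonneg_left (layerDev_sub_le hR hx hT.le le_rfl) N.c_pos.le
  have hθ : ∑ p, N.neuronTheta L ys p = N.theta L ys := rfl
  simp only [Finset.sum_add_distrib, ← Finset.sum_mul, ← Finset.mul_sum, hθ] at hneuron
  change layerDev x xs T ≤ (_ + (_ + (_ + N.quadConst L * R) * R * Ω)) * _
    + N.c * layerDev x xs (T - N.μ) at hneuron
  have hinitE := mul_le_mul_of_nonneg_right hinit (mlDecay_mem_Icc (N := N) T).1
  linarith

theorem layerDev_lt_mul_mlDecay (hEq : N.IsEquilibrium xs ys) (hker : N.IntegrableKernels)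
    (hlip : N.LipschitzActivations L M) (hsmall : N.SmallnessAssumption L M xs ys Ω)
    (hsol : N.IsSolution φ ψ x y) (hT : 0 < T) (hR : 0 < R) (hVR : 16 * V ≤ R)
    (hquad : Ω * N.quadConst L * R ≤ 1 / 16) (hV : ∀ s ≤ 0, layerDev x xs s ≤ V)
    (hx : ∀ s < T, layerDev x xs s ≤ R * mlDecay N.δ N.ξ s)
    (hy : ∀ s < T, layerDev y ys s ≤ R * mlDecay N.δ N.ξ s) :
    layerDev x xs T < R * mlDecay N.δ N.ξ T := by
  refine (layerDev_le_coeff_mul_mlDecay hEq hker hlip hsmall hsol hR.le hT hV hx hy).trans_lt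
    (mul_lt_mul_of_pos_right ?_ (mlDecay_pos N.δ_pos N.δ_lt_one N.ξ_pos.le T))
  have hneutral := mul_lt_mul_of_pos_right hsmall.c_mul_bStar_lt hR
  have hinter : Ω * (N.theta L ys + N.quadConst L * R) < 5 / 16 := by
    linarith [hsmall.mul_theta_lt]
  linarith [mul_lt_mul_of_pos_right hinter hR]

theorem max_layerDev_lt (hEq : N.IsEquilibrium xs ys) (hker : N.IntegrableKernels)
    (hlip : N.LipschitzActivations L M) (hsmall : N.SmallnessAssumption L M xs ys Ω)
    (hsol : N.IsSolution φ ψ x y) (hV : 0 < V)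
    (hquadX : Ω * N.quadConst L * (16 * V) ≤ 1 / 16)
    (hquadY : Ω * N.swap.quadConst M * (16 * V) ≤ 1 / 16)
    (hx : ∀ s ≤ 0, layerDev x xs s ≤ V) (hy : ∀ s ≤ 0, layerDev y ys s ≤ V)
    {t : ℝ} (ht : 0 ≤ t) :
    max (layerDev x xs t) (layerDev y ys t) < 16 * V * mlDecay N.δ N.ξ t := by
  have hR : 0 < 16 * V := by positivity
  have hhistory : ∀ s ≤ 0, max (layerDev x xs s) (layerDev y ys s)
      < 16 * V * mlDecay N.δ N.ξ s := fun s hs => by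
    rw [mlDecay_of_nonpos N.δ_pos hs, mul_one]
    exact (max_le (hx s hs) (hy s hs)).trans_lt (by linarith)
  refine lt_of_forall_first_time
    ((continuous_layerDev hsol.continuous_x).max
      (continuous_layerDev hsol.continuous_y)).continuousOn
    (continuous_const.mul (continuous_mlDecay N.δ_pos)).continuousOn (hhistory 0 le_rfl)
    (fun T hT hbefore => ?_) ht
  have hall : ∀ s < T, max (layerDev x xs s) (layerDev y ys s) < 16 * V * mlDecay N.δ N.ξ s :=
    fun s hs => (le_total s 0).elim (hhistory s) fun hs0 => hbefore s ⟨hs0, hs⟩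
  have hxT : ∀ s < T, layerDev x xs s ≤ 16 * V * mlDecay N.δ N.ξ s := fun s hs =>
    (le_max_left _ _).trans (hall s hs).le
  have hyT : ∀ s < T, layerDev y ys s ≤ 16 * V * mlDecay N.δ N.ξ s := fun s hs =>
    (le_max_right _ _).trans (hall s hs).le
  refine max_lt
    (layerDev_lt_mul_mlDecay hEq hker hlip hsmall hsol hT hR le_rfl hquadX hx hxT hyT) ?_
  rw [← ξ_swap] at hxT hyT ⊢
  exact layerDev_lt_mul_mlDecay hEq.swap hker.swap hlip.swap hsmall.swap hsol.swap hT hR le_rfl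
    hquadY hy hyT hxT

end BAMNetwork

theorem theorem2_general {n₁ n₂ : ℕ} [NeZero n₁] [NeZero n₂] (N : BAMNetwork n₁ n₂)
    (L : Fin n₂ → ℝ) (M : Fin n₁ → ℝ) (xs : Fin n₁ → ℝ) (ys : Fin n₂ → ℝ) (Ω : ℝ)
    (hEq : N.IsEquilibrium xs ys)
    (hker : N.IntegrableKernels) (hlip : N.LipschitzActivations L M)
    (hsmall : N.SmallnessAssumption L M xs ys Ω) :
    0 < N.ξ ∧ ∃ C > 0, ∃ ε > 0,
      ∀ (φ : Fin n₁ → ℝ → ℝ) (ψ : Fin n₂ → ℝ → ℝ) (x : Fin n₁ → ℝ → ℝ) (y : Fin n₂ → ℝ → ℝ)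
        (V : ℝ), N.IsSolution φ ψ x y → 0 < V → V < ε →
        (∀ w ≤ 0, layerDev φ xs w ≤ V) → (∀ w ≤ 0, layerDev ψ ys w ≤ V) →
        ∀ t > 0,
          layerDev x xs t ≤ C * V * mittagLeffler N.δ (-N.ξ * t ^ N.δ) ∧
          layerDev y ys t ≤ C * V * mittagLeffler N.δ (-N.ξ * t ^ N.δ) := by
  have hQX := BAMNetwork.quadConst_nonneg hker hlip.nonneg
  have hQY := BAMNetwork.quadConst_nonneg hker.swap hlip.swap.nonneg
  have hΩ := hsmall.Ω_pos
  refine ⟨N.ξ_pos, 16, by norm_num,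
    1 / (256 * (Ω * (N.quadConst L + N.swap.quadConst M) + 1)), by positivity,
    fun φ ψ x y V hsol hV hVε hφ hψ t ht => ?_⟩
  have hquad : V * (256 * (Ω * (N.quadConst L + N.swap.quadConst M) + 1)) < 1 :=
    (lt_div_iff₀ (by positivity)).1 hVε
  have hX : 0 ≤ V * (Ω * N.quadConst L) := by positivity
  have hY : 0 ≤ V * (Ω * N.swap.quadConst M) := by positivity
  have hbound := (BAMNetwork.max_layerDev_lt hEq hker hlip hsmall hsol hV (by linarith)
    (by linarith)
    (fun s hs => by simpa only [layerDev, hsol.history_x _ s hs] using hφ s hs)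
    (fun s hs => by simpa only [layerDev, hsol.history_y _ s hs] using hψ s hs) ht.le).le
  rw [mlDecay_of_nonneg ht.le, mlKernel_one] at hbound
  exact max_le_iff.1 hbound

theorem theorem2 {n₁ n₂ : ℕ} [NeZero n₁] [NeZero n₂] (N : BAMNetwork n₁ n₂)
    (L : Fin n₂ → ℝ) (M : Fin n₁ → ℝ) (xs : Fin n₁ → ℝ) (ys : Fin n₂ → ℝ) (Ω : ℝ)
    (hEq : N.IsEquilibrium xs ys)
    (hA1 : N.KernelAssumption) (hA3 : N.LipschitzActivations L M)
    (hA5 : N.SmallnessAssumption L M xs ys Ω) :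
    0 < N.ξ ∧ ∃ C > 0, ∃ ε > 0,
      ∀ (φ : Fin n₁ → ℝ → ℝ) (ψ : Fin n₂ → ℝ → ℝ) (x : Fin n₁ → ℝ → ℝ) (y : Fin n₂ → ℝ → ℝ)
        (u₀ v₀ V₀ : ℝ), N.IsSolution φ ψ x y → 0 < u₀ → 0 < v₀ → V₀ = max u₀ v₀ → V₀ < ε →
        (∀ w ≤ 0, ∑ p, |φ p w - xs p| ≤ u₀ * mlDecay N.δ N.aMin (w + N.μ)) →
        (∀ w ≤ 0, ∑ q, |ψ q w - ys q| ≤ v₀ * mlDecay N.δ N.abarMin (w + N.μ)) →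
        ∀ t > 0,
          ∑ p, |x p t - xs p| ≤ C * V₀ * mittagLeffler N.δ (-N.ξ * t ^ N.δ) ∧
          ∑ q, |y q t - ys q| ≤ C * V₀ * mittagLeffler N.δ (-N.ξ * t ^ N.δ) := by
  obtain ⟨hξ, C, hC, ε, hε, hstable⟩ :=
    theorem2_general N L M xs ys Ω hEq hA1.integrableKernels hA3 hA5
  refine ⟨hξ, C, hC, ε, hε, ?_⟩
  rintro φ ψ x y u₀ v₀ _ hsol hu₀ hv₀ rfl hV hφ hψ
  exact hstable φ ψ x y _ hsol (lt_max_of_lt_left hu₀) hV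
    (fun w hw => ((hφ w hw).trans (mul_le_of_le_one_right hu₀.le
      (mlDecay_le_one N.δ_pos N.δ_lt_one.le N.aMin_pos.le _))).trans (le_max_left _ _))
    (fun w hw => ((hψ w hw).trans (mul_le_of_le_one_right hv₀.le
      (mlDecay_le_one N.δ_pos N.δ_lt_one.le N.swap.aMin_pos.le _))).trans (le_max_right _ _))
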